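/- Let $R$ be a commutative Noetherian ring; all modules are finitely generated. Let $K$ be a semidualizing $R$-module, i.e. the homothety map $R\to\operatorname{Hom}_R(K,K)$ is bijective and $\operatorname{Ext}^i_R(K,K)=0$ for all $i>0$. Let $n\ge 0$ be an integer. Definitions. The grade of $M$ is $\operatorname{gr}_R(M)=\inf\{i\mid \operatorname{Ext}^i_R(M,R)\ne 0\}$ (so $\infty$ for $M=0$). Write $\operatorname{Ref}^n_K(R)$ for the class of modules $X$ of grade $n$ for which the natural map $\eta_K(X):X\to \operatorname{Ext}^n_R(\operatorname{Ext}^n_R(X,K),K)$ is an isomorphism. (Here $\eta_K(X)$ is the map that derived biduality $X\to\operatorname{RHom}(\operatorname{RHom}(X,K),K)$ induces in lowest degree; equivalently, $\eta_K(X)(x)$ is the pullback along $e\mapsto x\otimes e$ of the unique class in $\operatorname{Ext}^n_R(X\otimes_R\operatorname{Ext}^n_R(X,K),K)$ whose pullback along $X\to X\otimes_R\operatorname{Ext}^n_R(X,K)$, $x\mapsto x\otimes e$, is $e$ for every $e\in\operatorname{Ext}^n_R(X,K)$. For $n=0$ it is the evaluation map.) A full, isomorphism-closed subcategory $\mathcal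 X\subseteq \operatorname{Ref}^n_K(R)$ is called $n$-reflexive with respect to $K$ if $\operatorname{Ext}^n_R(X,K)\in\mathcal X$ for all $X\in\mathcal X$. $\operatorname{Epi}(\mathcal X)$ is the class of epimorphisms $\phi:X\twoheadrightarrow M$ with $X\in\mathcal X$ and $\operatorname{gr}_R(M)=\operatorname{gr}_R(X)$. For an epimorphism $\phi:X\twoheadrightarrow M$ with inclusion $j:\ker\phi\hookrightarrow X$, let $L(\phi):\operatorname{Ext}^n_R(X,K)\twoheadrightarrow \operatorname{im}\operatorname{Ext}^n_R(j,K)$ be the epimorphism induced by $\operatorname{Ext}^n_R(j,K)$. The module $M$ is linked by $\phi$ if $M=\operatorname{im}\phi$ and $M\cong\operatorname{im}L(L(\phi))$. $M$ is grade-unmixed if $\operatorname{depth}R_{\mathfrak p}=\operatorname{gr}_R(M)$ for all $\mathfrak p\in\operatorname{Ass}_R(M)$. The $\mathcal G_K$-dimension of a module is the least length of a resolution of it by totally $K$-reflexive modules, i.e. modules $G$ for which the evaluation map $G\to\operatorname{Hom}_R(\operatorname{Hom}_R(G,K),K)$ is bijective and $\operatorname{Ext}^i_R(G,K)=0=\operatorname{Ext}^i_R(\operatorname{Hom}_R(G,K),K)$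 for all $i>0$ (it is $\infty$ if there is no such resolution). The depth of the zero module is $\infty$. Statement. Let $\mathcal X$ be an $n$-reflexive subcategory with respect to $K$, and let $\phi\in\operatorname{Epi}(\mathcal X)$ be a non-injective homomorphism with $\operatorname{im}\phi=M$. Suppose that the $R_{\mathfrak p}$-module $M_{\mathfrak p}$ has finite $\mathcal G_{K_{\mathfrak p}}$-dimension for every prime $\mathfrak p$ of $R$ with $\operatorname{depth}R_{\mathfrak p}\le n$. Then the following are equivalent: (i) $M$ is linked by $\phi$; (ii) $M$ is grade-unmixed; (iii) $\operatorname{depth}_{R_{\mathfrak p}}(M_{\mathfrak p})\ge\min\{1,\operatorname{depth}R_{\mathfrak p}-n\}$ for all $\mathfrak p\in\operatorname{Spec}R$. -/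

import Mathlib

universe u

namespace ReflexiveLinkage

open CategoryTheory Abelian TensorProduct

noncomputable section

section Ext

variable (R : Type u) [CommRing R]

/-- The `R`-module `Extⁿ_R(M, N)`. -/
abbrev ExtMod (M N : Type u) [AddCommGroup M] [Module R M] [AddCommGroup N] [Module R N]
    (n : ℕ) : Type u :=
  Ext (ModuleCat.of R M) (ModuleCat.of R N) n

variable {R}

/-- The map `Extⁿ_R(f, K) : Extⁿ_R(Y, K) → Extⁿ_R(X, K)` induced by `f : X → Y`. -/
def extMap (K : Type u) [AddCommGroup K] [Module R K] (n : ℕ) {X Y : Type u}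
    [AddCommGroup X] [Module R X] [AddCommGroup Y] [Module R Y] (f : X →ₗ[R] Y) :
    ExtMod R Y K n →ₗ[R] ExtMod R X K n :=
  Ext.precompOfLinear (Ext.mk₀ (ModuleCat.ofHom f)) R (ModuleCat.of R K) (zero_add n)

/-- The smallest `i` with `Extⁱ_R(M, N) ≠ 0`, and `⊤` if there is none. -/
def extInf (R : Type u) [CommRing R] (M N : Type u) [AddCommGroup M] [Module R M]
    [AddCommGroup N] [Module R N] : ℕ∞ :=
  ⨅ (i : ℕ) (_ : Nontrivial (ExtMod R M N i)), (i : ℕ∞)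

/-- The grade of a finitely generated module: `inf {i | Extⁱ_R(M, R) ≠ 0}`; the zero module has
grade `⊤`. -/
def moduleGrade (R : Type u) [CommRing R] (M : Type u) [AddCommGroup M] [Module R M] : ℕ∞ :=
  extInf R M R

/-- The depth of a finitely generated module over a Noetherian local ring `A` with residue field
`k`: `inf {i | Extⁱ_A(k, M) ≠ 0}`; the zero module has depth `⊤`. -/
def moduleDepth (A : Type u) [CommRing A] [IsLocalRing A] (M : Type u) [AddCommGroup M] [Module A M] :
    ℕ∞ :=
  extInf A (IsLocalRing.ResidueField A) M

/-- `depth M_𝔭` over `R_𝔭`. -/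
def depthAt {R : Type u} [CommRing R] (p : PrimeSpectrum R) (M : Type u) [AddCommGroup M]
    [Module R M] : ℕ∞ :=
  moduleDepth (Localization.AtPrime p.asIdeal) (LocalizedModule.AtPrime p.asIdeal M)

/-- `depth R_𝔭`. -/
def depthRingAt {R : Type u} [CommRing R] (p : PrimeSpectrum R) : ℕ∞ :=
  moduleDepth (Localization.AtPrime p.asIdeal) (Localization.AtPrime p.asIdeal)

/-- `M` is grade-unmixed: `grade M = depth R_𝔭` for all `𝔭 ∈ Ass M`. -/
def IsGradeUnmixed (R : Type u) [CommRing R] (M : Type u) [AddCommGroup M] [Module R M] : Prop :=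
  ∀ p : PrimeSpectrum R, p.asIdeal ∈ associatedPrimes R M → moduleGrade R M = depthRingAt p

end Ext

section GKdim

variable (R : Type u) [CommRing R] (K : Type u) [AddCommGroup K] [Module R K]

/-- `K` is semidualizing: it is finitely generated, the homothety map `R → Hom(K, K)` is bijective,
and `Extⁱ(K, K) = 0` for all `i > 0`. -/
structure IsSemidualizing : Prop where
  finite : Module.Finite R K
  homothety : Function.Bijective (LinearMap.lsmul R K : R →ₗ[R] K →ₗ[R] K)
  ext_eq_zero : ∀ i : ℕ, 0 < i → Subsingleton (ExtMod R K K i)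

/-- `M` is totally `K`-reflexive: it is finitely generated, the evaluation map
`M → Hom(Hom(M, K), K)` is bijective, and `Extⁱ(M, K) = 0 = Extⁱ(Hom(M, K), K)` for all `i > 0`. -/
structure IsTotallyReflexive (M : Type u) [AddCommGroup M] [Module R M] : Prop where
  finite : Module.Finite R M
  biduality : Function.Bijective (LinearMap.applyₗ : M →ₗ[R] (M →ₗ[R] K) →ₗ[R] K)
  ext_eq_zero : ∀ i : ℕ, 0 < i → Subsingleton (ExtMod R M K i)
  ext_dual_eq_zero : ∀ i : ℕ, 0 < i → Subsingleton (ExtMod R (M →ₗ[R] K) K i)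

/-- `HasGKResolution R K d M`: there is an exact sequence `0 → G_d → ⋯ → G_0 → M → 0` with all `G_i`
totally `K`-reflexive. -/
def HasGKResolution : ℕ → ∀ (M : Type u) [AddCommGroup M] [Module R M], Prop
  | 0, M, _, _ => IsTotallyReflexive R K M
  | d + 1, M, _, _ => ∃ (G : ModuleCat.{u} R) (f : G →ₗ[R] M),
      IsTotallyReflexive R K G ∧ Function.Surjective f ∧ HasGKResolution d (LinearMap.ker f)

/-- The `G_K`-dimension of `M`: the minimal length of such a resolution, `⊤` if there is none. -/
def gkDim (M : Type u) [AddCommGroup M] [Module R M] : ℕ∞ :=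
  ⨅ (d : ℕ) (_ : HasGKResolution R K d M), (d : ℕ∞)

/-- `M` has finite `G_K`-dimension on the set of primes `𝔭` with `depth R_𝔭 ≤ n`. -/
def HasFiniteGKDimOn (n : ℕ) (M : Type u) [AddCommGroup M] [Module R M] : Prop :=
  ∀ p : PrimeSpectrum R, depthRingAt p ≤ n →
    gkDim (Localization.AtPrime p.asIdeal) (LocalizedModule.AtPrime p.asIdeal K)
      (LocalizedModule.AtPrime p.asIdeal M) < ⊤

end GKdim

section Eta

variable {R : Type u} [CommRing R] (K : Type u) [AddCommGroup K] [Module R K] (n : ℕ)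

/-- A class `α ∈ Extⁿ(M ⊗ N, K)` gives the map `M → Extⁿ(N, K)` that sends `m` to the pullback of
`α` along `N → M ⊗ N`, `x ↦ m ⊗ x`. For `n = 0` this is currying of bilinear maps. -/
def extCurry {M N : Type u} [AddCommGroup M] [Module R M] [AddCommGroup N] [Module R N]
    (α : ExtMod R (M ⊗[R] N) K n) : M →ₗ[R] ExtMod R N K n where
  toFun m := extMap K n (TensorProduct.mk R M N m) α
  map_add' m m' := by
    simp [extMap, ModuleCat.ofHom_add, Ext.mk₀_add]
  map_smul' r m := by
    have h {X Y : Type u} [AddCommGroup X] [Module R X] [AddCommGroup Y] [Module R Y]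
        (f : X →ₗ[R] Y) : ModuleCat.ofHom (r • f) = r • ModuleCat.ofHom f := rfl
    simp [extMap, h, Ext.mk₀_smul]

/-- The other curried map `N → Extⁿ(M, K)`, which sends `x` to the pullback of `α` along
`M → M ⊗ N`, `m ↦ m ⊗ x`. -/
def extCurryFlip {M N : Type u} [AddCommGroup M] [Module R M] [AddCommGroup N] [Module R N]
    (α : ExtMod R (M ⊗[R] N) K n) : N →ₗ[R] ExtMod R M K n where
  toFun x := extMap K n ((TensorProduct.mk R M N).flip x) α
  map_add' m m' := by
    simp [extMap, ModuleCat.ofHom_add, Ext.mk₀_add]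
  map_smul' r m := by
    have h {X Y : Type u} [AddCommGroup X] [Module R X] [AddCommGroup Y] [Module R Y]
        (f : X →ₗ[R] Y) : ModuleCat.ofHom (r • f) = r • ModuleCat.ofHom f := rfl
    simp [extMap, h, Ext.mk₀_smul]

end Eta

section Proofs

open scoped Pointwise

variable {R : Type u} [CommRing R] {K : Type u} [AddCommGroup K] [Module R K] {n : ℕ}

lemma extMap_apply {X Y : Type u} [AddCommGroup X] [Module R X] [AddCommGroup Y] [Module R Y]
    (f : X →ₗ[R] Y) (α : ExtMod R Y K n) :
    extMap K n f α = (Ext.mk₀ (ModuleCat.ofHom f)).comp α (zero_add n) := rfl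

lemma extMap_id {X : Type u} [AddCommGroup X] [Module R X] (α : ExtMod R X K n) :
    extMap K n LinearMap.id α = α := by
  simp [extMap_apply]

lemma extMap_comp {X Y Z : Type u} [AddCommGroup X] [Module R X] [AddCommGroup Y] [Module R Y]
    [AddCommGroup Z] [Module R Z] (f : X →ₗ[R] Y) (g : Y →ₗ[R] Z) (α : ExtMod R Z K n) :
    extMap K n (g ∘ₗ f) α = extMap K n f (extMap K n g α) := by
  simp [extMap_apply, ModuleCat.ofHom_comp, ← Ext.mk₀_comp_mk₀_assoc]

lemma extMap_sum {X Y : Type u} [AddCommGroup X] [Module R X] [AddCommGroup Y] [Module R Y]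
    {ι : Type*} (s : Finset ι) (f : ι → X →ₗ[R] Y) (α : ExtMod R Y K n) :
    extMap K n (∑ i ∈ s, f i) α = ∑ i ∈ s, extMap K n (f i) α := by
  classical
  induction s using Finset.induction_on with
  | empty =>
    have : ModuleCat.ofHom (0 : X →ₗ[R] Y) = 0 := rfl
    simp [extMap_apply, this]
  | insert a s ha ih =>
    rw [Finset.sum_insert ha, Finset.sum_insert ha, ← ih]
    simp [extMap_apply, ModuleCat.ofHom_add, Ext.mk₀_add]

lemma extMap_injective {X Y : Type u} [AddCommGroup X] [Module R X] [AddCommGroup Y] [Module R Y]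
    (f : X →ₗ[R] Y) (hf : Function.Surjective f)
    (h : ∀ i < n, Subsingleton (ExtMod R (LinearMap.ker f) K i)) :
    Function.Injective (extMap K n f) := by
  cases n with
  | zero =>
    have : Epi (ModuleCat.ofHom f) := (ModuleCat.epi_iff_surjective _).2 hf
    exact Ext.precomp_mk₀_injective_of_epi (ModuleCat.of R K) (ModuleCat.ofHom f)
  | succ k =>
    rw [injective_iff_map_eq_zero]
    intro α hα
    obtain ⟨β, rfl⟩ := Ext.contravariant_sequence_exact₃
      (LinearMap.shortExact_shortComplexKer hf) (ModuleCat.of R K) α hα (add_comm 1 k)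
    have : β = 0 := (h k (Nat.lt_succ_self k)).elim _ _
    simp [this]

lemma exists_extMap_eq {X Y : Type u} [AddCommGroup X] [Module R X] [AddCommGroup Y] [Module R Y]
    (f : X →ₗ[R] Y) (hf : Function.Surjective f) (β : ExtMod R X K n)
    (hβ : extMap K n (LinearMap.ker f).subtype β = 0) : ∃ α, extMap K n f α = β :=
  Ext.contravariant_sequence_exact₂ (LinearMap.shortExact_shortComplexKer hf)
    (ModuleCat.of R K) β hβ

lemma subsingleton_ext_of_isWeaklyRegular (L : Type u) [AddCommGroup L] [Module R L]
    (rs : List R) (hrs : ∀ r ∈ rs, r ∈ Module.annihilator R L) :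
    ∀ (K : Type u) [AddCommGroup K] [Module R K], RingTheory.Sequence.IsWeaklyRegular K rs →
      ∀ i < rs.length, Subsingleton (ExtMod R L K i) := by
  induction rs with
  | nil => simp
  | cons a rs ih =>
    intro K _ _ hK i hi
    rw [RingTheory.Sequence.isWeaklyRegular_cons_iff] at hK
    have ha : a ∈ Module.annihilator R L := hrs a List.mem_cons_self
    have hz (i : ℕ) (x : ExtMod R L K i) :
        x.comp (Ext.mk₀ (ModuleCat.smulShortComplex (ModuleCat.of R K) a).f) (add_zero i) = 0 := by
      have h0 : a • 𝟙 (ModuleCat.of R L) = 0 := by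
        ext y; exact Module.mem_annihilator.1 ha y
      have : a • x = (Ext.mk₀ (a • 𝟙 (ModuleCat.of R L))).comp x (zero_add i) := by
        simp [Ext.mk₀_smul]
      refine (Ext.smul_eq_comp_mk₀ x a).symm.trans ?_
      rw [this, h0, Ext.mk₀_zero]
      exact Ext.zero_comp _ _ _ _ _
    cases i with
    | zero =>
      have : Subsingleton (L →ₗ[R] K) :=
        IsSMulRegular.linearMap_subsingleton_of_mem_annihilator hK.1 ha
      exact (Ext.addEquiv₀.trans ModuleCat.homAddEquiv).subsingleton
    | succ i =>
      have h1 := ih (fun r hr => hrs r (List.mem_cons_of_mem _ hr)) (QuotSMulTop a K) hK.2 i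
        (by simpa using hi)
      refine subsingleton_of_forall_eq 0 fun x => ?_
      obtain ⟨y, rfl⟩ := Ext.covariant_sequence_exact₁ (ModuleCat.of R L)
        (IsSMulRegular.smulShortComplex_shortExact (M := ModuleCat.of R K) hK.1) x (hz _ x) rfl
      have : y = 0 := h1.elim _ _
      rw [this]
      exact Ext.zero_comp _ _ _ _ _

lemma IsSemidualizing.isWeaklyRegular [IsNoetherianRing R] (hK : IsSemidualizing R K)
    (rs : List R) : ∀ (K' : Type u) [AddCommGroup K'] [Module R K'] [Module.Finite R K'],
      (∀ i, 0 < i → Subsingleton (ExtMod R K K' i)) →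
      RingTheory.Sequence.IsWeaklyRegular (K →ₗ[R] K') rs →
      RingTheory.Sequence.IsWeaklyRegular K' rs := by
  have := hK.finite
  induction rs with
  | nil => simp
  | cons a rs ih =>
    intro K' _ _ _ hext hreg
    rw [RingTheory.Sequence.isWeaklyRegular_cons_iff] at hreg ⊢
    have ha : IsSMulRegular K' a := by
      let T : Submodule R K' := LinearMap.ker (LinearMap.lsmul R K' a)
      have hT : Subsingleton (K →ₗ[R] T) := by
        refine subsingleton_of_forall_eq 0 fun g => ?_
        have : T.subtype ∘ₗ g = 0 := by
          apply hreg.1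
          ext x
          simp only [smul_zero, LinearMap.zero_apply, LinearMap.smul_apply]
          exact LinearMap.mem_ker.1 (g x).2
        ext x
        simpa using LinearMap.congr_fun this x
      obtain ⟨r, hr, hrT⟩ := IsSMulRegular.subsingleton_linearMap_iff.1 hT
      have hr0 : r = 0 := by
        apply hK.homothety.1
        ext x
        simpa using Module.mem_annihilator.1 hr x
      subst hr0
      rw [isSMulRegular_iff_right_eq_zero_of_smul]
      intro x hx
      have := hrT (show (0 : R) • (⟨x, hx⟩ : T) = (0 : R) • (0 : T) by simp)
      simpa using congrArg Subtype.val this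
    refine ⟨ha, ?_⟩
    have hse := IsSMulRegular.smulShortComplex_shortExact (M := ModuleCat.of R K') ha
    refine ih (QuotSMulTop a K') (fun i hi => ?_) ?_
    · refine subsingleton_of_forall_eq 0 fun x => ?_
      obtain ⟨y, rfl⟩ := Ext.covariant_sequence_exact₃ (ModuleCat.of R K) hse x rfl
        ((hext (i + 1) (Nat.succ_pos i)).elim _ _)
      have : y = 0 := (hext i hi).elim _ _
      rw [this]
      exact Ext.zero_comp _ _ _ _ _
    · let q : (K →ₗ[R] K') →ₗ[R] (K →ₗ[R] QuotSMulTop a K') :=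
        (a • (⊤ : Submodule R K')).mkQ.compRight R
      have hq : Function.Surjective q := by
        intro g
        obtain ⟨y, hy⟩ := Ext.covariant_sequence_exact₃ (ModuleCat.of R K) hse
          (Ext.mk₀ (ModuleCat.ofHom g)) (n₁ := 1) rfl ((hext 1 one_pos).elim _ _)
        obtain ⟨f, rfl⟩ := Ext.addEquiv₀.symm.surjective y
        refine ⟨f.hom, ?_⟩
        simp only [Ext.addEquiv₀_symm_apply, Ext.mk₀_comp_mk₀] at hy
        have := Ext.addEquiv₀.symm.injective hy
        exact congrArg (fun t => ModuleCat.Hom.hom t) this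
      have hker : LinearMap.ker q = a • ⊤ := by
        ext f
        rw [Submodule.mem_smul_pointwise_iff_exists, LinearMap.mem_ker]
        constructor
        · intro hf
          have hmem (x : K) : ∃ y, a • y = f x := by
            have : (a • (⊤ : Submodule R K')).mkQ (f x) = 0 := LinearMap.congr_fun hf x
            rw [Submodule.mkQ_apply, Submodule.Quotient.mk_eq_zero,
              Submodule.mem_smul_pointwise_iff_exists] at this
            obtain ⟨y, -, hy⟩ := this
            exact ⟨y, hy⟩
          choose g hg using hmem
          refine ⟨{ toFun := g, map_add' := fun x y => ha ?_, map_smul' := fun r x => ha ?_ },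
            trivial, ?_⟩
          · simp [hg]
          · simp [hg, smul_comm a r]
          · ext x; exact hg x
        · rintro ⟨g, -, rfl⟩
          ext x
          simp only [q, LinearMap.compRight_apply, LinearMap.comp_apply, LinearMap.smul_apply,
            Submodule.mkQ_apply, LinearMap.zero_apply, Submodule.Quotient.mk_eq_zero]
          exact Submodule.smul_mem_pointwise_smul _ _ _ trivial
      let e : QuotSMulTop a (K →ₗ[R] K') ≃ₗ[R] (K →ₗ[R] QuotSMulTop a K') :=
        (Submodule.quotEquivOfEq _ _ hker.symm).trans (q.quotKerEquivOfSurjective hq)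
      exact (e.isWeaklyRegular_congr rs).1 hreg.2

/-- If `grade M ≥ n`, then `Extⁱ(L, K) = 0` for `i < n` and every `L` killed by `Ann M`. -/
lemma IsSemidualizing.subsingleton_ext [IsNoetherianRing R] (hK : IsSemidualizing R K)
    (M : Type u) [AddCommGroup M] [Module R M] [Module.Finite R M] (hM : (n : ℕ∞) ≤ moduleGrade R M)
    (L : Type u) [AddCommGroup L] [Module R L]
    (hL : Module.annihilator R M ≤ Module.annihilator R L) (i : ℕ) (hi : i < n) :
    Subsingleton (ExtMod R L K i) := by
  have := hK.finite
  by_cases htop : Module.annihilator R M = ⊤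
  · have : Subsingleton L := by
      have h1 := hL (htop ▸ Submodule.mem_top : (1 : R) ∈ _)
      exact subsingleton_of_forall_eq 0 fun x => by simpa using Module.mem_annihilator.1 h1 x
    refine subsingleton_of_forall_eq 0 fun x => ?_
    have h0 : (LinearMap.id : L →ₗ[R] L) = ∑ j ∈ (∅ : Finset ℕ), 0 := by
      ext y; exact Subsingleton.elim _ _
    rw [← extMap_id x, h0, extMap_sum, Finset.sum_empty]
  · obtain ⟨rs, hlen, hmem, hreg⟩ := ModuleCat.exists_isRegular_of_exists_subsingleton_ext
      (Module.annihilator R M) n (ModuleCat.of R R) (by simpa using lt_top_iff_ne_top.2 htop)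
      (ModuleCat.of R M) (Module.support_eq_zeroLocus) (fun i hi => by
        by_contra h
        rw [not_subsingleton_iff_nontrivial] at h
        have : moduleGrade R M ≤ i := iInf₂_le i h
        exact absurd (hM.trans this) (by simpa using hi))
    have hKreg := hK.isWeaklyRegular rs K hK.ext_eq_zero
      ((LinearEquiv.isWeaklyRegular_congr (LinearEquiv.ofBijective _ hK.homothety) rs).1
        hreg.toIsWeaklyRegular)
    exact subsingleton_ext_of_isWeaklyRegular L rs (fun r hr => hL (hmem r hr)) K hKreg i
      (hlen ▸ hi)
section Curry

variable {M N : Type u} [AddCommGroup M] [Module R M] [AddCommGroup N] [Module R N]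

lemma extCurryFlip_extMap_lTensor {N' : Type u} [AddCommGroup N'] [Module R N']
    (f : N' →ₗ[R] N) (α : ExtMod R (M ⊗[R] N) K n) :
    extCurryFlip K n (extMap K n (f.lTensor M) α) = extCurryFlip K n α ∘ₗ f := by
  ext1 x
  change extMap K n _ (extMap K n _ α) = extMap K n _ α
  rw [← extMap_comp]
  congr 1

lemma annihilator_le_ker_lTensor {N' : Type u} [AddCommGroup N'] [Module R N']
    (f : M ⊗[R] N' →ₗ[R] N) :
    Module.annihilator R M ≤ Module.annihilator R (LinearMap.ker f) := by
  intro r hr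
  refine Module.mem_annihilator.2 fun x => Subtype.ext ?_
  change r • (x : M ⊗[R] N') = 0
  induction (x : M ⊗[R] N') with
  | zero => simp
  | tmul m y => rw [TensorProduct.smul_tmul', Module.mem_annihilator.1 hr m, zero_tmul]
  | add a b ha hb => rw [smul_add, ha, hb, add_zero]

/-- Splitting off the `i`-th summand of `M ⊗ Rᵃ`. -/
def tensorProj (M : Type u) [AddCommGroup M] [Module R M] {a : ℕ} (i : Fin a) :
    M ⊗[R] (Fin a → R) →ₗ[R] M :=
  (TensorProduct.rid R M).toLinearMap ∘ₗ (LinearMap.proj i).lTensor M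

lemma sum_tensorProj {a : ℕ} :
    (LinearMap.id : M ⊗[R] (Fin a → R) →ₗ[R] _) = ∑ i, (TensorProduct.mk R M (Fin a → R)).flip
      (Pi.single i 1) ∘ₗ tensorProj M i := by
  refine TensorProduct.ext' fun m v => ?_
  simp only [LinearMap.id_apply, LinearMap.sum_apply, LinearMap.comp_apply, tensorProj,
    LinearMap.lTensor_tmul, LinearEquiv.coe_coe, TensorProduct.rid_tmul, LinearMap.flip_apply,
    TensorProduct.mk_apply, LinearMap.proj_apply, TensorProduct.smul_tmul]
  rw [← TensorProduct.tmul_sum]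
  congr 1
  ext j
  simp [Finset.sum_apply, Pi.single_apply]

lemma extCurryFlip_free_injective (M : Type u) [AddCommGroup M] [Module R M] (a : ℕ)
    (α : ExtMod R (M ⊗[R] (Fin a → R)) K n) (hα : extCurryFlip K n α = 0) : α = 0 := by
  rw [← extMap_id α, sum_tensorProj, extMap_sum]
  refine Finset.sum_eq_zero fun i _ => ?_
  rw [extMap_comp]
  have : extMap K n ((TensorProduct.mk R M (Fin a → R)).flip (Pi.single i 1)) α = 0 :=
    LinearMap.congr_fun hα _
  rw [this, map_zero]

lemma extCurryFlip_free_surjective (M : Type u) [AddCommGroup M] [Module R M] (a : ℕ)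
    (g : (Fin a → R) →ₗ[R] ExtMod R M K n) :
    ∃ α : ExtMod R (M ⊗[R] (Fin a → R)) K n, extCurryFlip K n α = g := by
  refine ⟨∑ i, extMap K n (tensorProj M i) (g (Pi.single i 1)), ?_⟩
  refine (Pi.basisFun R (Fin a)).ext fun j => ?_
  rw [Pi.basisFun_apply]
  change extMap K n _ (∑ i, _) = _
  rw [map_sum, Finset.sum_eq_single j]
  · rw [← extMap_comp]
    have : tensorProj M j ∘ₗ (TensorProduct.mk R M (Fin a → R)).flip (Pi.single j 1) =
        LinearMap.id := by
      ext m; simp [tensorProj]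
    rw [this, extMap_id]
  · intro i _ hij
    rw [← extMap_comp]
    have : tensorProj M i ∘ₗ (TensorProduct.mk R M (Fin a → R)).flip (Pi.single j 1) =
        ∑ k ∈ (∅ : Finset ℕ), 0 := by
      ext m; simp [tensorProj, hij]
    rw [this, extMap_sum, Finset.sum_empty]
  · simp

lemma extCurryFlip_injective [Module.Finite R N]
    (hV : ∀ (L : Type u) [AddCommGroup L] [Module R L],
      Module.annihilator R M ≤ Module.annihilator R L → ∀ i < n, Subsingleton (ExtMod R L K i))
    (α : ExtMod R (M ⊗[R] N) K n) (hα : extCurryFlip K n α = 0) : α = 0 := by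
  obtain ⟨a, f, hf⟩ := Module.Finite.exists_fin' R N
  refine extMap_injective (f.lTensor M) (LinearMap.lTensor_surjective M hf)
    (hV _ (annihilator_le_ker_lTensor _)) ?_
  rw [map_zero]
  apply extCurryFlip_free_injective
  rw [extCurryFlip_extMap_lTensor, hα, LinearMap.zero_comp]

lemma extCurryFlip_surjective [IsNoetherianRing R] [Module.Finite R N]
    (hV : ∀ (L : Type u) [AddCommGroup L] [Module R L],
      Module.annihilator R M ≤ Module.annihilator R L → ∀ i < n, Subsingleton (ExtMod R L K i))
    (g : N →ₗ[R] ExtMod R M K n) :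
    ∃ α : ExtMod R (M ⊗[R] N) K n, extCurryFlip K n α = g := by
  obtain ⟨a, f, hf⟩ := Module.Finite.exists_fin' R N
  obtain ⟨β, hβ⟩ := extCurryFlip_free_surjective M a (g ∘ₗ f)
  have hex := lTensor_exact M (LinearMap.exact_subtype_ker_map f) hf
  have hmem (x : M ⊗[R] LinearMap.ker f) :
      (LinearMap.ker f).subtype.lTensor M x ∈ LinearMap.ker (f.lTensor M) :=
    LinearMap.mem_ker.2 ((hex _).2 ⟨x, rfl⟩)
  let s := ((LinearMap.ker f).subtype.lTensor M).codRestrict (LinearMap.ker (f.lTensor M)) hmem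
  have hs : Function.Surjective s := by
    rintro ⟨y, hy⟩
    obtain ⟨x, hx⟩ := (hex y).1 (LinearMap.mem_ker.1 hy)
    exact ⟨x, Subtype.ext hx⟩
  obtain ⟨α, hα⟩ := exists_extMap_eq (f.lTensor M) (LinearMap.lTensor_surjective M hf) β (by
    apply extMap_injective s hs (hV _ (annihilator_le_ker_lTensor _))
    rw [map_zero, ← extMap_comp]
    have : (LinearMap.ker (f.lTensor M)).subtype ∘ₗ s = (LinearMap.ker f).subtype.lTensor M := rfl
    rw [this]
    apply extCurryFlip_injective hV
    rw [extCurryFlip_extMap_lTensor, hβ]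
    ext x
    have : f x = 0 := x.2
    simp [this])
  refine ⟨α, ?_⟩
  have h : extCurryFlip K n α ∘ₗ f = g ∘ₗ f := by
    rw [← extCurryFlip_extMap_lTensor, hα, hβ]
  ext1 x
  obtain ⟨y, rfl⟩ := hf x
  exact LinearMap.congr_fun h y

end Curry

/-- If `K` is semidualizing and `grade M ≥ n`, there is exactly one class in
`Extⁿ(M ⊗ Extⁿ(M, K), K)` whose pullback along `m ↦ m ⊗ e` is `e`, for every `e ∈ Extⁿ(M, K)`. -/
theorem existsUnique_extCurryFlip_eq_id [IsNoetherianRing R] (hK : IsSemidualizing R K)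
    (M : Type u) [AddCommGroup M] [Module R M] [Module.Finite R M] (hM : (n : ℕ∞) ≤ moduleGrade R M) :
    ∃! α : ExtMod R (M ⊗[R] ExtMod R M K n) K n, extCurryFlip K n α = LinearMap.id := by
  have := hK.finite
  have hfin : Module.Finite R (ExtMod R M K n) := inferInstance
  have hV : ∀ (L : Type u) [AddCommGroup L] [Module R L],
      Module.annihilator R M ≤ Module.annihilator R L → ∀ i < n, Subsingleton (ExtMod R L K i) :=
    fun L _ _ hL => hK.subsingleton_ext M hM L hL
  obtain ⟨α, hα⟩ := extCurryFlip_surjective (N := ExtMod R M K n) hV LinearMap.id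
  refine ⟨α, hα, fun β hβ => sub_eq_zero.1 (extCurryFlip_injective hV _ ?_)⟩
  have : extCurryFlip K n (β - α) = extCurryFlip K n β - extCurryFlip K n α := by
    ext x
    exact (extMap K n ((TensorProduct.mk R M (ExtMod R M K n)).flip x)).map_sub β α
  rw [this, hα, hβ, sub_self]

end Proofs

section NaturalMap

variable (R : Type u) [CommRing R] (K : Type u) [AddCommGroup K] [Module R K] (n : ℕ)
  (M : Type u) [AddCommGroup M] [Module R M]

/-- The evaluation class in `Extⁿ(M ⊗ Extⁿ(M, K), K)`, that is, the class that corresponds to the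
identity of `Extⁿ(M, K)`. It exists and is unique for the modules `M` of grade `≥ n`
(`existsUnique_extCurryFlip_eq_id`). It is the lowest-degree part of the derived evaluation
`M ⊗ᴸ RHom(M, K) → K`, and for `n = 0` it is the evaluation `M ⊗ Hom(M, K) → K`. -/
def evalClass : ExtMod R (M ⊗[R] ExtMod R M K n) K n :=
  Classical.epsilon fun α => extCurryFlip K n α = LinearMap.id

variable {R K n M} in
theorem extCurryFlip_evalClass [IsNoetherianRing R] (hK : IsSemidualizing R K) [Module.Finite R M]
    (hM : (n : ℕ∞) ≤ moduleGrade R M) : extCurryFlip K n (evalClass R K n M) = LinearMap.id :=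
  Classical.epsilon_spec (existsUnique_extCurryFlip_eq_id hK M hM).exists

/-- The natural map `η_K(M) : M → Extⁿ(Extⁿ(M, K), K)` of a module of grade `n`, the curried
evaluation class. For `n = 0` it is the evaluation map `M → Hom(Hom(M, K), K)`. -/
def eta : M →ₗ[R] ExtMod R (ExtMod R M K n) K n :=
  extCurry K n (evalClass R K n M)

variable {R K n M} in
/-- In degree `0`, `η` is the usual evaluation map: `η(m)` is the map
`Ext⁰(M, K) = Hom(M, K) → K`, `f ↦ f m`. -/
theorem eta_zero_apply [IsNoetherianRing R] (hK : IsSemidualizing R K) [Module.Finite R M]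
    (m : M) : eta R K 0 M m = Ext.mk₀ (ModuleCat.ofHom (LinearMap.applyₗ m ∘ₗ
      (Ext.linearEquiv₀.trans ModuleCat.homLinearEquiv : ExtMod R M K 0 ≃ₗ[R] M →ₗ[R] K))) := by
  obtain ⟨g, hg⟩ := Ext.addEquiv₀.symm.surjective (evalClass R K 0 M)
  rw [Ext.addEquiv₀_symm_apply] at hg
  change extMap K 0 (TensorProduct.mk R M _ m) (evalClass R K 0 M) = _
  rw [extMap_apply, ← hg, Ext.mk₀_comp_mk₀]
  congr 1
  refine ModuleCat.hom_ext (LinearMap.ext fun e => ?_)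
  have h : extMap K 0 ((TensorProduct.mk R M (ExtMod R M K 0)).flip e) (evalClass R K 0 M) = e :=
    LinearMap.congr_fun (extCurryFlip_evalClass (M := M) (n := 0) hK (by simp)) e
  obtain ⟨f, rfl⟩ := Ext.addEquiv₀.symm.surjective e
  rw [Ext.addEquiv₀_symm_apply] at h ⊢
  rw [extMap_apply, ← hg, Ext.mk₀_comp_mk₀] at h
  have h' := congrArg (fun t => ModuleCat.Hom.hom t m) (Ext.addEquiv₀.symm.injective h)
  have h2 : Ext.linearEquiv₀ (R := R) (Ext.mk₀ f) = f := Ext.addEquiv₀.apply_symm_apply f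
  refine Eq.trans h' ?_
  simp only [LinearMap.comp_apply, ModuleCat.hom_ofHom, LinearEquiv.coe_coe,
    LinearEquiv.trans_apply, h2]
  rfl

end NaturalMap

section Linkage

variable {R : Type u} [CommRing R] (K : Type u) [AddCommGroup K] [Module R K] (n : ℕ)

variable (R) in
/-- `M` belongs to `Ref^n_K(R)`: it is finitely generated of grade `n` and the natural map
`M → Extⁿ(Extⁿ(M, K), K)` is an isomorphism. -/
structure IsReflexiveOfGrade (M : Type u) [AddCommGroup M] [Module R M] : Prop where
  finite : Module.Finite R M
  grade_eq : moduleGrade R M = n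
  bijective_eta : Function.Bijective (eta R K n M)

/-- A (full, isomorphism-closed) subcategory of `R`-modules that is `n`-reflexive with respect to
`K`: it is contained in `Ref^n_K(R)` and closed under `Extⁿ(-, K)`. -/
structure IsNReflexive (𝒳 : ObjectProperty (ModuleCat.{u} R)) : Prop where
  isClosedUnderIsomorphisms : 𝒳.IsClosedUnderIsomorphisms
  isReflexive : ∀ X : ModuleCat.{u} R, 𝒳 X → IsReflexiveOfGrade R K n X
  ext_mem : ∀ X : ModuleCat.{u} R, 𝒳 X → 𝒳 (ModuleCat.of R (ExtMod R X K n))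

/-- `φ : X → M` belongs to `Epi(𝒳)`: it is surjective, `X ∈ 𝒳`, and `M` is finitely generated with
`grade M = grade X`. -/
structure IsEpiFrom (𝒳 : ObjectProperty (ModuleCat.{u} R)) {X M : Type u} [AddCommGroup X]
    [Module R X] [AddCommGroup M] [Module R M] (φ : X →ₗ[R] M) : Prop where
  source_mem : 𝒳 (ModuleCat.of R X)
  finite : Module.Finite R M
  surjective : Function.Surjective φ
  grade_eq : moduleGrade R M = moduleGrade R X

/-- `L(φ) : Extⁿ(X, K) ↠ im Extⁿ(j, K)`, where `j : ker φ → X` is the inclusion. -/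
def linkMap {X M : Type u} [AddCommGroup X] [Module R X] [AddCommGroup M] [Module R M]
    (φ : X →ₗ[R] M) :
    ExtMod R X K n →ₗ[R] LinearMap.range (extMap K n (LinearMap.ker φ).subtype) :=
  (extMap K n (LinearMap.ker φ).subtype).rangeRestrict

/-- The image `im φ` is linked by `φ`: `im φ ≅ im L(L(φ))`. -/
def IsLinkedBy {X M : Type u} [AddCommGroup X] [Module R X] [AddCommGroup M] [Module R M]
    (φ : X →ₗ[R] M) : Prop :=
  Nonempty (LinearMap.range φ ≃ₗ[R] LinearMap.range (linkMap K n (linkMap K n φ)))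
end Linkage

end

end ReflexiveLinkage

open ReflexiveLinkage

/-! Each of the three conditions is shown to be equivalent to: `depth R_𝔭 ≤ n` for every `𝔭 ∈ Ass
M`.

As `M` has grade `n`, its annihilator contains a weakly `R`-regular sequence `rs` of length `n`, and
`rs` is weakly `K`-regular because `R ≃ Hom(K, K)` and the higher `Ext(K, K)` vanish. Put `D = K /
(rs) K`. On modules killed by `rs`, the functor `Extⁿ(-, K)` is `Hom(-, D)`
(`exists_ext_class_bijective`), so `ker η(M)` consists of the elements killed by all maps `M → D`
(`eta_eq_zero_iff`). By naturality of `η` and surjectivity of `η(X)`, the module `im L(L(φ))` is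
isomorphic to `im η(M)`; hence linkage means that `η(M)` is injective, that is, that `M` is
`D`-torsionless (`isLinkedBy_iff_injective_eta`).

If `M` is `D`-torsionless, then `Ass M ⊆ Ass D`. Moreover `Ass D = Ass (R / (rs))`
(`IsSemidualizing.associatedPrimes_quotient_eq`), and a prime containing `rs` lies in this set if
and only if `depth R_𝔭 ≤ n` (`depthRingAt_le_length_iff`).

Conversely, a nonzero kernel of `η(M)` has an associated prime `𝔭`, and one localizes there. Now
`rs` is a maximal regular sequence and `M_𝔭` has finite `G`-dimension. Connecting maps embed `M_𝔭`
into `N / (rs) N` for an `n`-th syzygy `N` (`IsSyzygy.exists_injective`). Since `rs` is weakly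
regular on `N`, finite `G`-dimension forces `N` to be totally reflexive, as in the Auslander–Bridger
formula (`HasGKResolution.isTotallyReflexive`). Then functionals on `N` separate points modulo `rs`,
so `M_𝔭` is torsionless, contradicting the choice of `𝔭`. -/

namespace ReflexiveLinkage
open CategoryTheory Abelian TensorProduct

/-! ### Representing `Extⁿ(-, K)` by `K / (rs) K`; the kernel of `η`. -/

section EtaKernel

variable {R : Type u} [CommRing R]

lemma mk₀_comp_comp_assoc {X Y Z U V : ModuleCat.{u} R} (f : X ⟶ Y) (g : Y ⟶ Z) {m : ℕ}
    (β : Ext Z U m) (δ : Ext U V 1) :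
    ((Ext.mk₀ (f ≫ g)).comp β (zero_add m)).comp δ rfl =
      (Ext.mk₀ f).comp ((Ext.mk₀ g).comp (β.comp δ rfl) (zero_add (m + 1))) (zero_add (m + 1)) := by
  rw [Ext.mk₀_comp_mk₀_assoc]
  exact Ext.comp_assoc _ _ _ _ _ (by omega)

lemma extMap_zero {K X Y : Type u} [AddCommGroup K] [Module R K] [AddCommGroup X] [Module R X]
    [AddCommGroup Y] [Module R Y] {n : ℕ} (α : ExtMod R Y K n) :
    extMap K n (0 : X →ₗ[R] Y) α = 0 := by
  simpa using extMap_sum (∅ : Finset ℕ) (fun _ => (0 : X →ₗ[R] Y)) α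

lemma annihilator_le_annihilator_ext {K L : Type u} [AddCommGroup K] [Module R K]
    [AddCommGroup L] [Module R L] {m : ℕ} :
    Module.annihilator R L ≤ Module.annihilator R (ExtMod R L K m) := by
  intro a ha
  refine Module.mem_annihilator.2 fun x => ?_
  have h0 : a • 𝟙 (ModuleCat.of R L) = 0 := by
    ext y; exact Module.mem_annihilator.1 ha y
  have : a • x = (Ext.mk₀ (a • 𝟙 (ModuleCat.of R L))).comp x (zero_add _) := by
    simp [Ext.mk₀_smul]
  rw [this, h0, Ext.mk₀_zero]
  exact Ext.zero_comp _ _ _ _ _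

/-- Multiplication by `a` is zero on `Ext(L, K)`, so the long exact sequence of `0 → K → K → K / aK
→ 0` splits into short pieces; the vanishing of `Extᵐ(L, K)` removes the remaining term. -/
lemma postcomp_extClass_smulShortComplex_bijective {K L : Type u} [AddCommGroup K] [Module R K]
    [AddCommGroup L] [Module R L] {a : R} (ha : IsSMulRegular K a)
    (hL : a ∈ Module.annihilator R L) (m : ℕ) (h : Subsingleton (ExtMod R L K m)) :
    Function.Bijective
      ((IsSMulRegular.smulShortComplex_shortExact (M := ModuleCat.of R K) ha).extClass.postcomp
        (ModuleCat.of R L) (rfl : m + 1 = m + 1)) := by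
  constructor
  · rw [injective_iff_map_eq_zero]
    intro x hx
    obtain ⟨z, rfl⟩ := Ext.covariant_sequence_exact₃ (ModuleCat.of R L)
      (IsSMulRegular.smulShortComplex_shortExact (M := ModuleCat.of R K) ha) x rfl hx
    rw [h.elim z 0]
    exact Ext.zero_comp _ _ _ _ _
  · intro x
    obtain ⟨y, hy⟩ := Ext.covariant_sequence_exact₁ (ModuleCat.of R L)
      (IsSMulRegular.smulShortComplex_shortExact (M := ModuleCat.of R K) ha) x
      ((Ext.smul_eq_comp_mk₀ x a).symm.trans
        (Module.mem_annihilator.1 (annihilator_le_annihilator_ext hL) x)) rfl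
    exact ⟨y, hy⟩

/-- For a weakly `K`-regular sequence `rs` of length `n` there is a class in
`Extⁿ(K / (rs) K, K)` that represents `Extⁿ(-, K)` on the modules killed by `rs`. -/
lemma exists_ext_class_bijective (rs : List R) : ∀ (K : Type u) [AddCommGroup K] [Module R K],
    RingTheory.Sequence.IsWeaklyRegular K rs →
    ∃ β : ExtMod R (K ⧸ (Ideal.ofList rs • ⊤ : Submodule R K)) K rs.length,
      ∀ (L : Type u) [AddCommGroup L] [Module R L], (∀ r ∈ rs, r ∈ Module.annihilator R L) →
        Function.Bijective (fun f : L →ₗ[R] (K ⧸ (Ideal.ofList rs • ⊤ : Submodule R K)) =>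
          extMap K rs.length f β) := by
  induction rs with
  | nil =>
    intro K _ _ _
    let e : (K ⧸ (Ideal.ofList ([] : List R) • ⊤ : Submodule R K)) ≃ₗ[R] K :=
      Submodule.quotEquivOfEqBot _ (by simp)
    refine ⟨Ext.mk₀ (ModuleCat.ofHom e.toLinearMap), fun L _ _ _ => ?_⟩
    have : (fun f : L →ₗ[R] _ => extMap K 0 f (Ext.mk₀ (ModuleCat.ofHom e.toLinearMap))) =
        Ext.mk₀ ∘ ModuleCat.ofHom ∘ (fun f => e.toLinearMap ∘ₗ f) := by
      funext f
      simp [extMap_apply]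
    refine this.symm ▸ (Ext.mk₀_bijective _ _).comp (Function.Bijective.comp
      ⟨fun _ _ h => congrArg ModuleCat.Hom.hom h, fun f => ⟨f.hom, rfl⟩⟩
      (LinearEquiv.congrRight e).bijective)
  | cons a rs ih =>
    intro K _ _ hK
    rw [RingTheory.Sequence.isWeaklyRegular_cons_iff] at hK
    obtain ⟨β, hβ⟩ := ih (QuotSMulTop a K) hK.2
    let e := Submodule.quotOfListConsSMulTopEquivQuotSMulTopInner K a rs
    let δ := (IsSMulRegular.smulShortComplex_shortExact (M := ModuleCat.of R K) hK.1).extClass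
    -- The class for `a :: rs` is the class of `rs` over `K / aK`, shifted by one degree with the
    -- connecting class.
    refine ⟨(Ext.mk₀ (ModuleCat.ofHom e.toLinearMap)).comp (Ext.comp β δ rfl) (zero_add _),
      fun L _ _ hL => ?_⟩
    have hs := subsingleton_ext_of_isWeaklyRegular L (a :: rs) hL K
      ((RingTheory.Sequence.isWeaklyRegular_cons_iff _ _ _).2 hK) rs.length (by simp)
    have h1 := postcomp_extClass_smulShortComplex_bijective hK.1 (hL a List.mem_cons_self) _ hs
    have h2 := hβ L (fun r hr => hL r (List.mem_cons_of_mem _ hr))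
    have h3 := h1.comp (h2.comp (LinearEquiv.congrRight (M := L) e).bijective)
    refine Eq.subst (motive := Function.Bijective) (funext fun f => ?_) h3
    exact mk₀_comp_comp_assoc (ModuleCat.ofHom f) (ModuleCat.ofHom e.toLinearMap) β δ

variable {K : Type u} [AddCommGroup K] [Module R K]

/-- The kernel of `η` is the intersection of the kernels of the maps to `K / (rs) K`. -/
lemma eta_eq_zero_iff [IsNoetherianRing R] (hK : IsSemidualizing R K) {M : Type u}
    [AddCommGroup M] [Module R M] [Module.Finite R M] (rs : List R)
    (hM : (rs.length : ℕ∞) ≤ moduleGrade R M) (hrs : ∀ r ∈ rs, r ∈ Module.annihilator R M)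
    (hreg : RingTheory.Sequence.IsWeaklyRegular K rs) (m : M) :
    eta R K rs.length M m = 0 ↔
      ∀ f : M →ₗ[R] (K ⧸ (Ideal.ofList rs • ⊤ : Submodule R K)), f m = 0 := by
  obtain ⟨β, hβ⟩ := exists_ext_class_bijective rs K hreg
  have hD : ∀ r ∈ rs, r ∈ Module.annihilator R (ExtMod R M K rs.length) :=
    fun r hr => annihilator_le_annihilator_ext (hrs r hr)
  have hT : ∀ r ∈ rs, r ∈ Module.annihilator R (M ⊗[R] ExtMod R M K rs.length) := by
    intro r hr
    refine Module.mem_annihilator.2 fun x => ?_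
    induction x with
    | zero => simp
    | tmul m y => rw [TensorProduct.smul_tmul', Module.mem_annihilator.1 (hrs r hr) m, zero_tmul]
    | add a b ha hb => rw [smul_add, ha, hb, add_zero]
  -- The evaluation class is the pullback of `β` along a pairing `h : M ⊗ Extⁿ(M, K) → K / (rs) K`,
  -- so `η(m) = 0` says that `h (m ⊗ -) = 0`.
  obtain ⟨h, hh⟩ := (hβ _ hT).2 (evalClass R K rs.length M)
  simp only at hh
  have key : eta R K rs.length M m = 0 ↔ h ∘ₗ TensorProduct.mk R M _ m = 0 := by
    change extMap K _ (TensorProduct.mk R M _ m) (evalClass R K rs.length M) = 0 ↔ _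
    rw [← hh, ← extMap_comp]
    constructor
    · intro h1
      exact (hβ _ hD).1 (h1.trans (extMap_zero β).symm)
    · intro h1
      rw [h1, extMap_zero]
  rw [key]
  constructor
  · intro h0 f
    -- Every `f` occurs in the pairing: for `e` the pullback of `β` along `f`, the map `h (- ⊗ e)`
    -- has the same pullback, hence equals `f`.
    have h1 := LinearMap.congr_fun (extCurryFlip_evalClass hK hM) (extMap K _ f β)
    change extMap K _ ((TensorProduct.mk R M _).flip _) (evalClass R K rs.length M) =
      extMap K _ f β at h1
    rw [← hh, ← extMap_comp] at h1
    have h2 := (hβ _ hrs).1 h1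
    rw [← h2]
    exact LinearMap.congr_fun h0 _
  · intro h0
    ext1 e
    exact h0 (h ∘ₗ (TensorProduct.mk R M _).flip e)

end EtaKernel

/-! ### Naturality of `η`, and linkage as injectivity of `η(M)`. -/

section Linked

variable {R : Type u} [CommRing R] {K : Type u} [AddCommGroup K] [Module R K] {n : ℕ}
variable {X M : Type u} [AddCommGroup X] [Module R X] [AddCommGroup M] [Module R M]

/-- Both sides curry classes in `Extⁿ(X ⊗ Extⁿ(M, K), K)`. A class there is determined by its other
currying, and for both classes that is `e ↦ extMap K n f e`. -/
lemma eta_naturality [IsNoetherianRing R] (hK : IsSemidualizing R K) [Module.Finite R X]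
    [Module.Finite R M] (hX : (n : ℕ∞) ≤ moduleGrade R X) (hM : (n : ℕ∞) ≤ moduleGrade R M)
    (f : X →ₗ[R] M) (x : X) :
    extMap K n (extMap K n f) (eta R K n X x) = eta R K n M (f x) := by
  have := hK.finite
  have hfin : Module.Finite R (ExtMod R M K n) := inferInstance
  have h : extMap K n ((extMap K n f).lTensor X) (evalClass R K n X) =
      extMap K n (f.rTensor (ExtMod R M K n)) (evalClass R K n M) := by
    rw [← sub_eq_zero]
    refine extCurryFlip_injective (fun L _ _ hL => hK.subsingleton_ext X hX L hL) _ ?_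
    ext1 e
    change extMap K n ((TensorProduct.mk R X (ExtMod R M K n)).flip e) (_ - _) = 0
    rw [map_sub, sub_eq_zero, ← extMap_comp, ← extMap_comp]
    have h1 : (extMap K n f).lTensor X ∘ₗ (TensorProduct.mk R X (ExtMod R M K n)).flip e =
      (TensorProduct.mk R X (ExtMod R X K n)).flip (extMap K n f e) := rfl
    have h2 : f.rTensor (ExtMod R M K n) ∘ₗ (TensorProduct.mk R X (ExtMod R M K n)).flip e =
      (TensorProduct.mk R M (ExtMod R M K n)).flip e ∘ₗ f := rfl
    rw [h1, h2, extMap_comp]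
    have e1 : extMap K n ((TensorProduct.mk R X (ExtMod R X K n)).flip (extMap K n f e))
        (evalClass R K n X) = extMap K n f e :=
      LinearMap.congr_fun (extCurryFlip_evalClass hK hX) _
    have e2 : extMap K n ((TensorProduct.mk R M (ExtMod R M K n)).flip e)
        (evalClass R K n M) = e :=
      LinearMap.congr_fun (extCurryFlip_evalClass hK hM) _
    rw [e1, e2]
  change extMap K n _ (extMap K n (TensorProduct.mk R X _ x) _) =
    extMap K n (TensorProduct.mk R M _ (f x)) _
  rw [← extMap_comp]
  have h1 : TensorProduct.mk R X _ x ∘ₗ extMap K n f = (extMap K n f).lTensor X ∘ₗ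
    TensorProduct.mk R X _ x := rfl
  have h2 : TensorProduct.mk R M (ExtMod R M K n) (f x) = f.rTensor (ExtMod R M K n) ∘ₗ
    TensorProduct.mk R X _ x := rfl
  rw [h1, h2, extMap_comp, extMap_comp, h]

lemma ker_linkMap (φ : X →ₗ[R] M) (hφ : Function.Surjective φ) :
    LinearMap.ker (linkMap K n φ) = LinearMap.range (extMap K n φ) := by
  ext β
  rw [LinearMap.mem_ker, LinearMap.mem_range]
  constructor
  · intro h
    exact exists_extMap_eq φ hφ β (congrArg Subtype.val h)
  · rintro ⟨α, rfl⟩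
    refine Subtype.ext ?_
    change extMap K n (LinearMap.ker φ).subtype (extMap K n φ α) = 0
    rw [← extMap_comp]
    rw [LinearMap.comp_ker_subtype, extMap_zero]

/-- The isomorphism `Extⁿ(Y, K) ≃ Extⁿ(X, K)` induced by `X ≃ Y`. -/
noncomputable def extMapEquiv (K : Type u) [AddCommGroup K] [Module R K] (n : ℕ) {X Y : Type u}
    [AddCommGroup X] [Module R X] [AddCommGroup Y] [Module R Y] (e : X ≃ₗ[R] Y) :
    ExtMod R Y K n ≃ₗ[R] ExtMod R X K n :=
  LinearEquiv.ofLinearMap (extMap K n e.toLinearMap) (extMap K n e.symm.toLinearMap)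
    (by ext1 x; simp [← extMap_comp, extMap_id]) (by ext1 x; simp [← extMap_comp, extMap_id])

/-- `M` is linked by `φ` if and only if `η(M)` is injective. -/
lemma isLinkedBy_iff_injective_eta [IsNoetherianRing R] (hK : IsSemidualizing R K)
    [Module.Finite R X] [Module.Finite R M] (hX : (n : ℕ∞) ≤ moduleGrade R X)
    (hM : (n : ℕ∞) ≤ moduleGrade R M) (hη : Function.Surjective (eta R K n X))
    (φ : X →ₗ[R] M) (hφ : Function.Surjective φ) :
    IsLinkedBy K n φ ↔ Function.Injective (eta R K n M) := by
  -- With `ker_linkMap` this identifies the kernel of `L(φ)` with `Extⁿ(M, K)`, so `L(L(φ))` is, up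
  -- to isomorphism, `Extⁿ(Extⁿ(φ, K), K)` onto its image.
  have hinj : Function.Injective (extMap K n φ) :=
    extMap_injective φ hφ fun i hi => hK.subsingleton_ext X hX _
      (LinearMap.annihilator_le_of_injective _ (LinearMap.ker φ).injective_subtype) i hi
  let e : ExtMod R M K n ≃ₗ[R] LinearMap.ker (linkMap K n φ) :=
    (LinearEquiv.ofInjective _ hinj).trans
      (LinearEquiv.ofEq _ _ (ker_linkMap φ hφ).symm)
  have he : (LinearMap.ker (linkMap K n φ)).subtype ∘ₗ e.toLinearMap = extMap K n φ := rfl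
  let E := extMapEquiv K n e
  have h1 : E.toLinearMap ∘ₗ extMap K n (LinearMap.ker (linkMap K n φ)).subtype =
      extMap K n (extMap K n φ) := by
    ext1 x
    rw [← he, extMap_comp]
    rfl
  have hrange : (LinearMap.range (extMap K n (LinearMap.ker (linkMap K n φ)).subtype)).map
      E.toLinearMap = LinearMap.range (eta R K n M) := by
    rw [← LinearMap.range_comp, h1]
    ext y
    constructor
    · rintro ⟨z, rfl⟩
      obtain ⟨x, rfl⟩ := hη z
      exact ⟨φ x, (eta_naturality hK hX hM φ x).symm⟩
    · rintro ⟨m, rfl⟩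
      obtain ⟨x, rfl⟩ := hφ m
      exact ⟨_, eta_naturality hK hX hM φ x⟩
  have e1 : LinearMap.range (linkMap K n (linkMap K n φ)) ≃ₗ[R] LinearMap.range (eta R K n M) :=
    ((LinearEquiv.ofTop _ (LinearMap.range_eq_top.2 (LinearMap.surjective_rangeRestrict _))).trans
      (E.submoduleMap _)).trans (LinearEquiv.ofEq _ _ hrange)
  have e2 : LinearMap.range φ ≃ₗ[R] M := LinearEquiv.ofTop _ (LinearMap.range_eq_top.2 hφ)
  constructor
  · rintro ⟨e3⟩
    -- An abstract isomorphism suffices: it makes `M → im η(M) ≃ M` a surjective endomorphism of a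
    -- Noetherian module, hence injective.
    let g := ((e2.symm.trans e3).trans e1).symm
    have hs : Function.Surjective (g.toLinearMap ∘ₗ (eta R K n M).rangeRestrict) :=
      g.surjective.comp (LinearMap.surjective_rangeRestrict _)
    have hi := IsNoetherian.injective_of_surjective_endomorphism _ hs
    intro x y hxy
    exact hi (congrArg g (Subtype.ext hxy :
      (eta R K n M).rangeRestrict x = (eta R K n M).rangeRestrict y))
  · intro h
    exact ⟨(e2.trans (LinearEquiv.ofInjective _ h)).trans e1.symm⟩

end Linked

/-! ### `Hom(V, C)` modulo a regular sequence when the higher `Ext(V, C)` vanish. -/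

section HomQuotient

open scoped Pointwise
open RingTheory.Sequence

variable {R : Type u} [CommRing R]

lemma mem_ofList_cons_smul_top_iff {C : Type u} [AddCommGroup C] [Module R C] (a : R)
    (rs : List R) (x : C) :
    x ∈ (Ideal.ofList (a :: rs) • ⊤ : Submodule R C) ↔
      (Submodule.Quotient.mk x : QuotSMulTop a C) ∈
        (Ideal.ofList rs • ⊤ : Submodule R (QuotSMulTop a C)) := by
  have h := (Submodule.quotOfListConsSMulTopEquivQuotSMulTopInner C a rs).map_eq_zero_iff
    (x := Submodule.Quotient.mk x)
  rw [Submodule.Quotient.mk_eq_zero] at h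
  rw [← h, ← Submodule.Quotient.mk_eq_zero]
  rfl

lemma mem_smul_top_iff {C : Type u} [AddCommGroup C] [Module R C] (a : R) (x : C) :
    x ∈ (a • ⊤ : Submodule R C) ↔ ∃ y, a • y = x := by
  simp [Submodule.mem_smul_pointwise_iff_exists]

lemma quotSMulTop_mk_eq_zero_iff {C : Type u} [AddCommGroup C] [Module R C] (a : R) (x : C) :
    (Submodule.Quotient.mk x : QuotSMulTop a C) = 0 ↔ ∃ y, a • y = x := by
  rw [Submodule.Quotient.mk_eq_zero, mem_smul_top_iff]

variable {V : Type u} [AddCommGroup V] [Module R V]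

lemma exists_mkQ_comp_eq {C : Type u} [AddCommGroup C] [Module R C] {a : R}
    (ha : IsSMulRegular C a) (hext : Subsingleton (ExtMod R V C 1))
    (g : V →ₗ[R] QuotSMulTop a C) :
    ∃ f : V →ₗ[R] C, (a • (⊤ : Submodule R C)).mkQ ∘ₗ f = g := by
  obtain ⟨y, hy⟩ := Ext.covariant_sequence_exact₃ (ModuleCat.of R V)
    (IsSMulRegular.smulShortComplex_shortExact (M := ModuleCat.of R C) ha)
    (Ext.mk₀ (ModuleCat.ofHom g)) (n₁ := 1) rfl (hext.elim _ _)
  obtain ⟨f, rfl⟩ := Ext.addEquiv₀.symm.surjective y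
  refine ⟨f.hom, ?_⟩
  simp only [Ext.addEquiv₀_symm_apply, Ext.mk₀_comp_mk₀] at hy
  have := Ext.addEquiv₀.symm.injective hy
  exact congrArg (fun t => ModuleCat.Hom.hom t) this

lemma exists_smul_eq_of_mkQ_comp_eq_zero {C : Type u} [AddCommGroup C] [Module R C] {a : R}
    (ha : IsSMulRegular C a) (f : V →ₗ[R] C) (hf : (a • (⊤ : Submodule R C)).mkQ ∘ₗ f = 0) :
    ∃ g : V →ₗ[R] C, a • g = f := by
  have hmem (x : V) : ∃ y, a • y = f x :=
    (quotSMulTop_mk_eq_zero_iff a (f x)).1 (LinearMap.congr_fun hf x)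
  choose g hg using hmem
  refine ⟨{ toFun := g, map_add' := fun x y => ha ?_, map_smul' := fun r x => ha ?_ }, ?_⟩
  · simp [hg]
  · simp [hg, smul_comm a r]
  · ext x; exact hg x

/-- `Hom(V, C) / a Hom(V, C) ≃ Hom(V, C / a C)`. -/
noncomputable def quotSMulTopHomEquiv {C : Type u} [AddCommGroup C] [Module R C] {a : R}
    (ha : IsSMulRegular C a) (hext : Subsingleton (ExtMod R V C 1)) :
    QuotSMulTop a (V →ₗ[R] C) ≃ₗ[R] (V →ₗ[R] QuotSMulTop a C) :=
  (Submodule.quotEquivOfEq _ _ (by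
    ext f
    rw [mem_smul_top_iff, LinearMap.mem_ker]
    constructor
    · rintro ⟨g, rfl⟩
      ext x
      exact (quotSMulTop_mk_eq_zero_iff a _).2 ⟨g x, rfl⟩
    · exact exists_smul_eq_of_mkQ_comp_eq_zero ha f)).trans
  (((a • (⊤ : Submodule R C)).mkQ.compRight R).quotKerEquivOfSurjective
    (exists_mkQ_comp_eq ha hext))

lemma subsingleton_ext_quotSMulTop {C : Type u} [AddCommGroup C] [Module R C] {a : R}
    (ha : IsSMulRegular C a) (hext : ∀ i, 0 < i → Subsingleton (ExtMod R V C i)) (i : ℕ)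
    (hi : 0 < i) : Subsingleton (ExtMod R V (QuotSMulTop a C) i) := by
  refine subsingleton_of_forall_eq 0 fun x => ?_
  obtain ⟨y, rfl⟩ := Ext.covariant_sequence_exact₃ (ModuleCat.of R V)
    (IsSMulRegular.smulShortComplex_shortExact (M := ModuleCat.of R C) ha) x rfl
    ((hext (i + 1) (Nat.succ_pos i)).elim _ _)
  have : y = 0 := (hext i hi).elim _ _
  rw [this]
  exact Ext.zero_comp _ _ _ _ _

/-- Since `Hom(V, C) / a ≃ Hom(V, C / aC)` and the vanishing of `Ext` passes to `C / aC`, one can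
induct on the sequence. -/
lemma isWeaklyRegular_linearMap (rs : List R) : ∀ (C : Type u) [AddCommGroup C] [Module R C],
    IsWeaklyRegular C rs → (∀ i, 0 < i → Subsingleton (ExtMod R V C i)) →
    IsWeaklyRegular (V →ₗ[R] C) rs := by
  induction rs with
  | nil => simp
  | cons a rs ih =>
    intro C _ _ hC hext
    rw [isWeaklyRegular_cons_iff] at hC ⊢
    refine ⟨fun f g hfg => LinearMap.ext fun v => hC.1 (LinearMap.congr_fun hfg v), ?_⟩
    exact ((quotSMulTopHomEquiv hC.1 (hext 1 one_pos)).isWeaklyRegular_congr rs).2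
      (ih _ hC.2 (subsingleton_ext_quotSMulTop hC.1 hext))

lemma exists_lift_quotient (rs : List R) : ∀ (C : Type u) [AddCommGroup C] [Module R C],
    IsWeaklyRegular C rs → (∀ i, 0 < i → Subsingleton (ExtMod R V C i)) →
    ∀ g : V →ₗ[R] C ⧸ (Ideal.ofList rs • ⊤ : Submodule R C),
      ∃ f : V →ₗ[R] C, (Ideal.ofList rs • ⊤ : Submodule R C).mkQ ∘ₗ f = g := by
  induction rs with
  | nil =>
    intro C _ _ _ _ g
    let e : (C ⧸ (Ideal.ofList ([] : List R) • ⊤ : Submodule R C)) ≃ₗ[R] C :=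
      Submodule.quotEquivOfEqBot _ (by simp)
    refine ⟨e.toLinearMap ∘ₗ g, ?_⟩
    ext v
    exact e.injective (e.apply_symm_apply (e (g v)))
  | cons a rs ih =>
    intro C _ _ hC hext g
    rw [isWeaklyRegular_cons_iff] at hC
    let e := Submodule.quotOfListConsSMulTopEquivQuotSMulTopInner C a rs
    obtain ⟨f, hf⟩ := ih _ hC.2 (subsingleton_ext_quotSMulTop hC.1 hext) (e.toLinearMap ∘ₗ g)
    obtain ⟨f', rfl⟩ := exists_mkQ_comp_eq hC.1 (hext 1 one_pos) f
    refine ⟨f', LinearMap.ext fun v => e.injective ?_⟩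
    exact LinearMap.congr_fun hf v

/-- This is injectivity of `Hom(V, C) / (rs) → Hom(V, C / (rs) C)`. With `V = Hom(G, C)` for a
totally reflexive `G`, it lets functionals test membership in `(rs) G`. -/
lemma mem_smul_top_linearMap (rs : List R) : ∀ (C : Type u) [AddCommGroup C] [Module R C],
    IsWeaklyRegular C rs → (∀ i, 0 < i → Subsingleton (ExtMod R V C i)) →
    ∀ f : V →ₗ[R] C, (∀ v, f v ∈ (Ideal.ofList rs • ⊤ : Submodule R C)) →
      f ∈ (Ideal.ofList rs • ⊤ : Submodule R (V →ₗ[R] C)) := by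
  induction rs with
  | nil =>
    intro C _ _ _ _ f hf
    have : f = 0 := by ext v; simpa using hf v
    simp [this]
  | cons a rs ih =>
    intro C _ _ hC hext f hf
    rw [isWeaklyRegular_cons_iff] at hC
    rw [mem_ofList_cons_smul_top_iff]
    let e := quotSMulTopHomEquiv (V := V) hC.1 (hext 1 one_pos)
    have h := ih _ hC.2 (subsingleton_ext_quotSMulTop hC.1 hext)
      ((a • (⊤ : Submodule R C)).mkQ ∘ₗ f) fun v => (mem_ofList_cons_smul_top_iff a rs _).1 (hf v)
    have h2 := Submodule.mem_map_of_mem (f := e.symm.toLinearMap) h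
    rw [Submodule.map_smul'', Submodule.map_top, LinearEquiv.range] at h2
    have h3 : e.symm ((a • (⊤ : Submodule R C)).mkQ ∘ₗ f) = Submodule.Quotient.mk f :=
      e.symm_apply_eq.2 rfl
    rw [← h3]
    exact h2

end HomQuotient

/-! ### Regular sequences on exact sequences, syzygies, and connecting maps. -/

section Exact

open scoped Pointwise
open RingTheory.Sequence

variable {R : Type u} [CommRing R]

lemma quotSMulTop_map_injective {A B C : Type u} [AddCommGroup A] [Module R A] [AddCommGroup B]
    [Module R B] [AddCommGroup C] [Module R C] {i : A →ₗ[R] B} {p : B →ₗ[R] C}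
    (hi : Function.Injective i) (hip : Function.Exact i p) {a : R} (ha : IsSMulRegular C a) :
    Function.Injective (QuotSMulTop.map a i) := by
  rw [injective_iff_map_eq_zero]
  intro x hx
  obtain ⟨x, rfl⟩ := Submodule.Quotient.mk_surjective _ x
  obtain ⟨b, hb⟩ := (quotSMulTop_mk_eq_zero_iff a (i x)).1 hx
  have hpb : p b = 0 := by
    apply ha
    simp only [smul_zero]
    rw [← map_smul, hb, hip.apply_apply_eq_zero]
  obtain ⟨y, rfl⟩ := (hip b).1 hpb
  exact (quotSMulTop_mk_eq_zero_iff a x).2 ⟨y, hi (by rw [map_smul, hb])⟩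

/-- Regularity of `a` on `C` keeps the sequence exact modulo `a`, so the induction replaces all
three modules by their quotients. The second conclusion is injectivity of `A / (rs) A → B / (rs) B`.
-/
lemma isWeaklyRegular_of_exact (rs : List R) : ∀ {A B C : Type u} [AddCommGroup A] [Module R A]
    [AddCommGroup B] [Module R B] [AddCommGroup C] [Module R C] {i : A →ₗ[R] B} {p : B →ₗ[R] C},
    Function.Injective i → Function.Exact i p → Function.Surjective p →
    IsWeaklyRegular B rs → IsWeaklyRegular C rs → IsWeaklyRegular A rs ∧
      ∀ x, i x ∈ (Ideal.ofList rs • ⊤ : Submodule R B) →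
        x ∈ (Ideal.ofList rs • ⊤ : Submodule R A) := by
  induction rs with
  | nil =>
    intro A B C _ _ _ _ _ _ i p hi _ _ _ _
    refine ⟨by simp, fun x hx => ?_⟩
    have : i x = 0 := by simpa using hx
    simpa using (map_eq_zero_iff i hi).1 this
  | cons a rs ih =>
    intro A B C _ _ _ _ _ _ i p hi hip hp hB hC
    rw [isWeaklyRegular_cons_iff] at hB hC
    obtain ⟨h1, h2⟩ := ih (quotSMulTop_map_injective hi hip hC.1) (QuotSMulTop.map_exact a hip hp)
      (QuotSMulTop.map_surjective a hp) hB.2 hC.2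
    refine ⟨(isWeaklyRegular_cons_iff _ _ _).2 ⟨hB.1.of_injective i hi, h1⟩, fun x hx => ?_⟩
    rw [mem_ofList_cons_smul_top_iff] at hx ⊢
    exact h2 _ hx

/-- `IsSyzygy rs k M N`: the module `N` is a `k`-th syzygy of `M`, in an exact sequence
`0 → N → G_{k-1} → ⋯ → G_0 → M → 0` in which `rs` is weakly regular on all `G_i`. -/
def IsSyzygy (rs : List R) : ℕ → ∀ (M N : Type u) [AddCommGroup M] [Module R M] [AddCommGroup N]
    [Module R N], Prop
  | 0, M, N, _, _, _, _ => Nonempty (N ≃ₗ[R] M)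
  | k + 1, M, N, _, _, _, _ => ∃ (G P : ModuleCat.{u} R) (i : P →ₗ[R] G) (p : G →ₗ[R] M),
      Function.Injective i ∧ Function.Exact i p ∧ Function.Surjective p ∧
        IsWeaklyRegular G rs ∧ IsSyzygy rs k P N

/-- Every intermediate kernel embeds in some `G`, so `a` is regular on it and each short exact
sequence survives reduction modulo `a`. -/
lemma IsSyzygy.quotSMulTop {a : R} {rs : List R} (k : ℕ) : ∀ {M N : Type u} [AddCommGroup M]
    [Module R M] [AddCommGroup N] [Module R N], IsSyzygy (a :: rs) k M N → IsSMulRegular M a →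
    IsSMulRegular N a ∧ IsSyzygy rs k (QuotSMulTop a M) (QuotSMulTop a N) := by
  induction k with
  | zero =>
    rintro M N _ _ _ _ ⟨e⟩ hM
    exact ⟨hM.of_injective e.toLinearMap e.injective, ⟨QuotSMulTop.congr a e⟩⟩
  | succ k ih =>
    rintro M N _ _ _ _ ⟨G, P, i, p, hi, hip, hp, hG, h⟩ hM
    rw [isWeaklyRegular_cons_iff] at hG
    obtain ⟨h1, h2⟩ := ih h (hG.1.of_injective i hi)
    exact ⟨h1, ModuleCat.of R (QuotSMulTop a G), ModuleCat.of R (QuotSMulTop a P),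
      QuotSMulTop.map a i, QuotSMulTop.map a p, quotSMulTop_map_injective hi hip hM,
      QuotSMulTop.map_exact a hip hp, QuotSMulTop.map_surjective a hp, hG.2, h2⟩

/-- The connecting map of multiplication by `a` on `0 → P → G → M → 0`. -/
lemma exists_injective_quotSMulTop {P G M L : Type u} [AddCommGroup P] [Module R P]
    [AddCommGroup G] [Module R G] [AddCommGroup M] [Module R M] [AddCommGroup L] [Module R L]
    {i : P →ₗ[R] G} {p : G →ₗ[R] M} (hi : Function.Injective i) (hip : Function.Exact i p)
    (hp : Function.Surjective p) {a : R} (ha : IsSMulRegular G a) (u : L →ₗ[R] M)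
    (hu : Function.Injective u) (hL : a ∈ Module.annihilator R L) :
    ∃ v : L →ₗ[R] QuotSMulTop a P, Function.Injective v := by
  choose g hg using fun l => hp (u l)
  have hz (l : L) : ∃ x, i x = a • g l := by
    refine (hip _).1 ?_
    rw [map_smul, hg, ← map_smul, Module.mem_annihilator.1 hL, map_zero]
  choose x hx using hz
  -- Two lifts of an element of `M` differ by an element of `P`, so the class modulo `a P` does not
  -- depend on the lift; this makes `v` linear.
  have key (y : P) (b : G) (hb : p b = 0) (hy : i y = a • b) :
      (Submodule.Quotient.mk y : QuotSMulTop a P) = 0 := by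
    obtain ⟨c, rfl⟩ := (hip b).1 hb
    exact (quotSMulTop_mk_eq_zero_iff a y).2 ⟨c, hi (by rw [hy, map_smul])⟩
  let v : L →ₗ[R] QuotSMulTop a P :=
    { toFun l := Submodule.Quotient.mk (x l)
      map_add' l l' := by
        rw [← Submodule.Quotient.mk_add, ← sub_eq_zero, ← Submodule.Quotient.mk_sub]
        exact key _ (g (l + l') - (g l + g l')) (by simp [hg]) (by simp [hx, smul_sub])
      map_smul' r l := by
        rw [RingHom.id_apply, ← Submodule.Quotient.mk_smul, ← sub_eq_zero,
          ← Submodule.Quotient.mk_sub]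
        exact key _ (g (r • l) - r • g l) (by simp [hg]) (by simp [hx, smul_sub, smul_comm a r]) }
  refine ⟨v, (injective_iff_map_eq_zero v).2 fun l hl => ?_⟩
  obtain ⟨q, hq⟩ := (quotSMulTop_mk_eq_zero_iff a (x l)).1 hl
  have : g l = i q := ha (by simp only; rw [← hx, ← hq, map_smul])
  rw [← map_eq_zero_iff u hu, ← hg, this, hip.apply_apply_eq_zero]

/-- A module `L ⊆ M` killed by `rs` embeds into `N / (rs) N`, where `N` is a syzygy of `M` of order
the length of `rs`. -/
lemma IsSyzygy.exists_injective (rs : List R) : ∀ {M N L : Type u} [AddCommGroup M] [Module R M]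
    [AddCommGroup N] [Module R N] [AddCommGroup L] [Module R L], IsSyzygy rs rs.length M N →
    (∀ r ∈ rs, r ∈ Module.annihilator R L) → ∀ u : L →ₗ[R] M, Function.Injective u →
    IsWeaklyRegular N rs ∧ ∃ v : L →ₗ[R] N ⧸ (Ideal.ofList rs • ⊤ : Submodule R N),
      Function.Injective v := by
  induction rs with
  | nil =>
    rintro M N L _ _ _ _ _ _ ⟨e⟩ _ u hu
    let e' : (N ⧸ (Ideal.ofList ([] : List R) • ⊤ : Submodule R N)) ≃ₗ[R] N :=
      Submodule.quotEquivOfEqBot _ (by simp)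
    refine ⟨by simp, (e'.trans e).symm.toLinearMap ∘ₗ u, ?_⟩
    exact (e'.trans e).symm.injective.comp hu
  | cons a rs ih =>
    rintro M N L _ _ _ _ _ _ ⟨G, P, i, p, hi, hip, hp, hG, h⟩ hL u hu
    rw [isWeaklyRegular_cons_iff] at hG
    -- Each element of the sequence uses up one syzygy: `a` kills `L` and may fail to be regular on
    -- `M`, but it is regular on `P ⊆ G`. So `L` embeds in `P / aP`, whose syzygy of order one less
    -- is `N / aN`.
    obtain ⟨h1, h2⟩ := IsSyzygy.quotSMulTop _ h (hG.1.of_injective i hi)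
    obtain ⟨v, hv⟩ := exists_injective_quotSMulTop hi hip hp hG.1 u hu (hL a List.mem_cons_self)
    obtain ⟨h3, w, hw⟩ := ih h2 (fun r hr => hL r (List.mem_cons_of_mem _ hr)) v hv
    let e := Submodule.quotOfListConsSMulTopEquivQuotSMulTopInner N a rs
    exact ⟨(isWeaklyRegular_cons_iff _ _ _).2 ⟨h1, h3⟩, e.symm.toLinearMap ∘ₗ w,
      e.symm.injective.comp hw⟩

end Exact

/-! ### Totally reflexive modules and finite `G_C`-dimension over a local ring. -/

section TotallyReflexive

open RingTheory.Sequence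

variable {R : Type u} [CommRing R] {C : Type u} [AddCommGroup C] [Module R C]

lemma subsingleton_ext_of_subsingleton {M : Type u} [AddCommGroup M] [Module R M] [Subsingleton M]
    (i : ℕ) : Subsingleton (ExtMod R M C i) := by
  refine subsingleton_of_forall_eq 0 fun x => ?_
  rw [← extMap_id x, Subsingleton.elim (LinearMap.id : M →ₗ[R] M) 0, extMap_zero]

lemma isTotallyReflexive_of_subsingleton (M : Type u) [AddCommGroup M] [Module R M]
    [Subsingleton M] : IsTotallyReflexive R C M where
  finite := inferInstance
  biduality := ⟨Function.injective_of_subsingleton _, fun f => ⟨0, by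
    ext g
    rw [Subsingleton.elim g 0, map_zero, map_zero]⟩⟩
  ext_eq_zero i _ := subsingleton_ext_of_subsingleton i
  ext_dual_eq_zero i _ := subsingleton_ext_of_subsingleton i

lemma HasGKResolution.finite {d : ℕ} {M : Type u} [AddCommGroup M] [Module R M]
    (h : HasGKResolution R C d M) : Module.Finite R M := by
  cases d with
  | zero => exact IsTotallyReflexive.finite h
  | succ d =>
    obtain ⟨G, f, hG, hf, -⟩ := h
    have := hG.finite
    exact Module.Finite.of_surjective f hf

lemma IsTotallyReflexive.isWeaklyRegular {G : Type u} [AddCommGroup G] [Module R G]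
    (hG : IsTotallyReflexive R C G) {rs : List R} (hC : IsWeaklyRegular C rs) :
    IsWeaklyRegular G rs :=
  ((LinearEquiv.ofBijective _ hG.biduality).isWeaklyRegular_congr rs).2
    (isWeaklyRegular_linearMap rs C hC hG.ext_dual_eq_zero)

lemma IsTotallyReflexive.mem_smul_top {G : Type u} [AddCommGroup G] [Module R G]
    (hG : IsTotallyReflexive R C G) {rs : List R} (hC : IsWeaklyRegular C rs) (g : G)
    (hg : ∀ f : G →ₗ[R] C, f g ∈ (Ideal.ofList rs • ⊤ : Submodule R C)) :
    g ∈ (Ideal.ofList rs • ⊤ : Submodule R G) := by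
  let e := LinearEquiv.ofBijective _ hG.biduality
  have h1 := mem_smul_top_linearMap rs C hC hG.ext_dual_eq_zero (e g) hg
  have h2 := Submodule.mem_map_of_mem (f := e.symm.toLinearMap) h1
  rw [Submodule.map_smul'', Submodule.map_top, LinearEquiv.range] at h2
  simpa using h2

lemma HasGKResolution.exists_syzygy {rs : List R} (hC : IsWeaklyRegular C rs) (k : ℕ) :
    ∀ {d : ℕ} {M : Type u} [AddCommGroup M] [Module R M], HasGKResolution R C d M →
      ∃ (d' : ℕ) (N : ModuleCat.{u} R), HasGKResolution R C d' N ∧ IsSyzygy rs k M N := by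
  induction k with
  | zero =>
    intro d M _ _ h
    exact ⟨d, ModuleCat.of R M, h, ⟨LinearEquiv.refl R M⟩⟩
  | succ k ih =>
    intro d M _ _ h
    cases d with
    | zero =>
      have hM : IsTotallyReflexive R C M := h
      -- An exhausted resolution is continued by zero modules, so the order of a syzygy may exceed
      -- the length of the resolution.
      obtain ⟨d', N, hN, hs⟩ := ih (d := 0) (M := PUnit.{u + 1})
        (isTotallyReflexive_of_subsingleton PUnit)
      exact ⟨d', N, hN, ModuleCat.of R M, ModuleCat.of R PUnit, 0, LinearMap.id,
        Function.injective_of_subsingleton _, fun x => by simp [eq_comm], Function.surjective_id,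
        hM.isWeaklyRegular hC, hs⟩
    | succ d =>
      obtain ⟨G, f, hG, hf, h'⟩ := h
      obtain ⟨d', N, hN, hs⟩ := ih h'
      exact ⟨d', N, hN, G, ModuleCat.of R (LinearMap.ker f), (LinearMap.ker f).subtype, f,
        Subtype.val_injective, LinearMap.exact_subtype_ker_map f, hf, hG.isWeaklyRegular hC, hs⟩

lemma exists_linearMap_comp_eq {A B D : Type u} [AddCommGroup A] [Module R A] [AddCommGroup B]
    [Module R B] [AddCommGroup D] [Module R D] (q : A →ₗ[R] B) (hq : Function.Surjective q)
    (h : A →ₗ[R] D) (hh : ∀ a, q a = 0 → h a = 0) : ∃ ξ : B →ₗ[R] D, ξ ∘ₗ q = h := by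
  let e := q.quotKerEquivOfSurjective hq
  refine ⟨(LinearMap.ker q).liftQ h hh ∘ₗ e.symm.toLinearMap, ?_⟩
  ext a
  have : e.symm (q a) = Submodule.Quotient.mk a := e.symm_apply_eq.2 rfl
  rw [LinearMap.comp_apply, LinearMap.comp_apply, LinearEquiv.coe_coe, this]
  exact Submodule.liftQ_apply _ _ _

lemma shortExact_shortComplexOfCompEqZero {A B D : Type u} [AddCommGroup A] [Module R A]
    [AddCommGroup B] [Module R B] [AddCommGroup D] [Module R D] {i : A →ₗ[R] B} {p : B →ₗ[R] D}
    (hi : Function.Injective i) (hip : Function.Exact i p) (hp : Function.Surjective p) :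
    (ModuleCat.shortComplexOfCompEqZero i p hip.linearMap_comp_eq_zero).ShortExact where
  exact := ModuleCat.shortComplex_exact _ hip
  mono_f := (ModuleCat.mono_iff_injective _).2 hi
  epi_g := (ModuleCat.epi_iff_surjective _).2 hp

variable {P G N : Type u} [AddCommGroup P] [Module R P] [AddCommGroup G] [Module R G]
  [AddCommGroup N] [Module R N] {i : P →ₗ[R] G} {p : G →ₗ[R] N}

lemma exact_lcomp (hip : Function.Exact i p) (hp : Function.Surjective p) :
    Function.Exact (p.lcomp R C) (i.lcomp R C) := by
  intro f
  constructor
  · intro hf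
    obtain ⟨ξ, hξ⟩ := exists_linearMap_comp_eq p hp f fun a ha => by
      obtain ⟨b, rfl⟩ := (hip a).1 ha
      exact LinearMap.congr_fun hf b
    exact ⟨ξ, hξ⟩
  · rintro ⟨ξ, rfl⟩
    ext x
    simp [hip.apply_apply_eq_zero]

lemma injective_lcomp (hp : Function.Surjective p) : Function.Injective (p.lcomp R C) := by
  intro f g hfg
  ext x
  obtain ⟨y, rfl⟩ := hp x
  exact LinearMap.congr_fun hfg y

/-- A module with a two-term totally reflexive resolution that dualizes to an exact sequence is
totally reflexive. -/
lemma isTotallyReflexive_of_surjective_lcomp (hi : Function.Injective i)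
    (hip : Function.Exact i p) (hp : Function.Surjective p) (hP : IsTotallyReflexive R C P)
    (hG : IsTotallyReflexive R C G) (hs : Function.Surjective (i.lcomp R C)) :
    IsTotallyReflexive R C N := by
  have hS := shortExact_shortComplexOfCompEqZero hi hip hp
  have hD := shortExact_shortComplexOfCompEqZero (injective_lcomp (C := C) hp)
    (exact_lcomp hip hp) hs
  have := hG.finite
  refine ⟨Module.Finite.of_surjective p hp, ⟨?_, fun ξ => ?_⟩, fun j hj => ?_, fun j hj => ?_⟩
  · rw [injective_iff_map_eq_zero]
    intro n hn
    obtain ⟨g, rfl⟩ := hp n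
    -- Evaluation at `g` kills the functionals that come from `N`, so it factors through `Hom(P,
    -- C)`; by biduality of `P` it is evaluation at some `i x`.
    obtain ⟨ξ, hξ⟩ := exists_linearMap_comp_eq (i.lcomp R C) hs
      (LinearMap.applyₗ g : (G →ₗ[R] C) →ₗ[R] C) fun f hf => by
        obtain ⟨f', rfl⟩ := (exact_lcomp hip hp f).1 hf
        exact LinearMap.congr_fun hn f'
    obtain ⟨x, rfl⟩ := hP.biduality.2 ξ
    have : g = i x := hG.biduality.1 (LinearMap.ext fun f => (LinearMap.congr_fun hξ f).symm)
    rw [this, hip.apply_apply_eq_zero]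
  -- The obstruction to extending `ξ` from `Hom(N, C)` to `Hom(G, C)` lies in `Ext¹(Hom(P, C), C) =
  -- 0`.
  · obtain ⟨y, hy⟩ := Ext.contravariant_sequence_exact₁ hD (ModuleCat.of R C)
      (Ext.mk₀ (ModuleCat.ofHom ξ)) (n₁ := 1) rfl ((hP.ext_dual_eq_zero 1 one_pos).elim _ _)
    obtain ⟨f, rfl⟩ := Ext.addEquiv₀.symm.surjective y
    simp only [Ext.addEquiv₀_symm_apply, Ext.mk₀_comp_mk₀] at hy
    have hf := congrArg (fun t => ModuleCat.Hom.hom t) (Ext.addEquiv₀.symm.injective hy)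
    obtain ⟨g, hg⟩ := hG.biduality.2 f.hom
    refine ⟨p g, LinearMap.ext fun t => ?_⟩
    exact (LinearMap.congr_fun hg (p.lcomp R C t)).trans (LinearMap.congr_fun hf t)
  · refine subsingleton_of_forall_eq 0 fun x => ?_
    obtain ⟨j, rfl⟩ := Nat.exists_eq_succ_of_ne_zero hj.ne'
    obtain ⟨y, rfl⟩ := Ext.contravariant_sequence_exact₃ hS (ModuleCat.of R C) x
      ((hG.ext_eq_zero _ hj).elim _ _) (add_comm 1 j)
    -- The assumption `hs` is needed only in degree `0`, that is, for `Ext¹(N, C) = 0`.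
    have : ∃ z : ExtMod R G C j, extMap C j i z = y := by
      rcases j with _ | j
      · obtain ⟨φ, rfl⟩ := Ext.addEquiv₀.symm.surjective y
        obtain ⟨ψ, hψ⟩ := hs φ.hom
        refine ⟨Ext.mk₀ (ModuleCat.ofHom ψ), ?_⟩
        rw [extMap_apply, Ext.mk₀_comp_mk₀, Ext.addEquiv₀_symm_apply]
        congr 1
        exact ModuleCat.hom_ext hψ
      · exact ⟨0, (hP.ext_eq_zero _ j.succ_pos).elim _ _⟩
    obtain ⟨z, rfl⟩ := this
    rw [extMap_apply]
    exact hS.extClass_comp_assoc z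
  · refine subsingleton_of_forall_eq 0 fun x => ?_
    obtain ⟨y, rfl⟩ := Ext.contravariant_sequence_exact₁ hD (ModuleCat.of R C) x (add_comm 1 j)
      ((hP.ext_dual_eq_zero _ (by omega)).elim _ _)
    have : y = 0 := (hG.ext_dual_eq_zero j hj).elim _ _
    rw [this]
    exact Ext.comp_zero _ _ _ _ _

variable [IsNoetherianRing R] [IsLocalRing R]

/-- If `Hom(W, D) = 0`, some element of `Ann W` is regular on `D`. A unit cannot kill `W ≠ 0`, and a
nonunit kills the socle element `c`. -/
lemma exists_linearMap_ne_zero_of_socle {D W : Type u} [AddCommGroup D] [Module R D]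
    [Module.Finite R D] [AddCommGroup W] [Module R W] [Module.Finite R W] [Nontrivial W] (c : D)
    (hc : c ≠ 0) (hmc : ∀ r ∈ IsLocalRing.maximalIdeal R, r • c = 0) :
    ∃ f : W →ₗ[R] D, f ≠ 0 := by
  by_contra! h
  have : Subsingleton (W →ₗ[R] D) := subsingleton_of_forall_eq 0 h
  obtain ⟨r, hr, hrD⟩ := IsSMulRegular.subsingleton_linearMap_iff.1 this
  by_cases hu : IsUnit r
  · obtain ⟨w, hw⟩ := exists_ne (0 : W)
    exact hw (hu.smul_eq_zero.1 (Module.mem_annihilator.1 hr w))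
  · exact hc (hrD (by simpa using hmc r ((IsLocalRing.mem_maximalIdeal r).2 hu)))

variable [Module.Finite R C] {rs : List R}

/-- A nonzero cokernel `W` would map nontrivially to `C / (rs) C`. The resulting map on `Hom(P, C)`
lifts to `C`, hence is evaluation at some `x ∈ P` modulo `rs`. It vanishes on restrictions of
functionals of `G`, so `i x ∈ (rs) G`; regularity on `N` gives `x ∈ (rs) P`, and the map is zero. -/
lemma surjective_lcomp_of_socle (hC : IsWeaklyRegular C rs)
    (c : C ⧸ (Ideal.ofList rs • ⊤ : Submodule R C)) (hc : c ≠ 0)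
    (hmc : ∀ r ∈ IsLocalRing.maximalIdeal R, r • c = 0) (hi : Function.Injective i)
    (hip : Function.Exact i p) (hp : Function.Surjective p) (hP : IsTotallyReflexive R C P)
    (hG : IsTotallyReflexive R C G) (hN : IsWeaklyRegular N rs) :
    Function.Surjective (i.lcomp R C) := by
  by_contra hs
  have := hP.finite
  let W := (P →ₗ[R] C) ⧸ LinearMap.range (i.lcomp R C)
  have hW : Nontrivial W := Submodule.Quotient.nontrivial_iff.2 (mt LinearMap.range_eq_top.1 hs)
  obtain ⟨f, hf⟩ := exists_linearMap_ne_zero_of_socle (W := W) c hc hmc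
  obtain ⟨h, hh⟩ := exists_lift_quotient rs C hC hP.ext_dual_eq_zero
    (f ∘ₗ (LinearMap.range (i.lcomp R C)).mkQ)
  obtain ⟨x, rfl⟩ := hP.biduality.2 h
  have hix : i x ∈ (Ideal.ofList rs • ⊤ : Submodule R G) := by
    refine hG.mem_smul_top hC _ fun ψ => ?_
    have h1 := LinearMap.congr_fun hh (i.lcomp R C ψ)
    have h2 : (LinearMap.range (i.lcomp R C)).mkQ (i.lcomp R C ψ) = 0 :=
      (Submodule.Quotient.mk_eq_zero _).2 ⟨ψ, rfl⟩
    rw [LinearMap.comp_apply, LinearMap.comp_apply, h2, map_zero] at h1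
    exact (Submodule.Quotient.mk_eq_zero _).1 h1
  have hx := (isWeaklyRegular_of_exact rs hi hip hp (hG.isWeaklyRegular hC) hN).2 x hix
  refine hf (Submodule.linearMap_qext _ ?_)
  rw [← hh]
  ext1 φ
  refine (Submodule.Quotient.mk_eq_zero _).2 ?_
  have := Submodule.mem_map_of_mem (f := φ) hx
  rw [Submodule.map_smul''] at this
  exact Submodule.smul_mono le_rfl le_top this

lemma HasGKResolution.isTotallyReflexive (hC : IsWeaklyRegular C rs)
    (c : C ⧸ (Ideal.ofList rs • ⊤ : Submodule R C)) (hc : c ≠ 0)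
    (hmc : ∀ r ∈ IsLocalRing.maximalIdeal R, r • c = 0) : ∀ {d : ℕ} {N : Type u} [AddCommGroup N]
    [Module R N], HasGKResolution R C d N → IsWeaklyRegular N rs → IsTotallyReflexive R C N := by
  intro d
  induction d with
  | zero => intro N _ _ h _; exact h
  | succ d ih =>
    rintro N _ _ ⟨G, f, hG, hf, h⟩ hN
    have hex := LinearMap.exact_subtype_ker_map f
    have hi : Function.Injective (LinearMap.ker f).subtype := Subtype.val_injective
    have hP := ih h (isWeaklyRegular_of_exact rs hi hex hf (hG.isWeaklyRegular hC) hN).1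
    exact isTotallyReflexive_of_surjective_lcomp hi hex hf hP hG
      (surjective_lcomp_of_socle hC c hc hmc hi hex hf hP hG hN)

/-- A module of finite `G_C`-dimension killed by a `C`-regular sequence `rs` of length `depth C`
is `C / (rs) C`-torsionless. -/
theorem HasGKResolution.exists_linearMap_ne_zero (hC : IsWeaklyRegular C rs)
    (c : C ⧸ (Ideal.ofList rs • ⊤ : Submodule R C)) (hc : c ≠ 0)
    (hmc : ∀ r ∈ IsLocalRing.maximalIdeal R, r • c = 0) {d : ℕ} {M : Type u} [AddCommGroup M]
    [Module R M] (hM : HasGKResolution R C d M) (hrs : ∀ r ∈ rs, r ∈ Module.annihilator R M)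
    (z : M) (hz : z ≠ 0) :
    ∃ g : M →ₗ[R] C ⧸ (Ideal.ofList rs • ⊤ : Submodule R C), g z ≠ 0 := by
  obtain ⟨d', N, hN, hs⟩ := hM.exists_syzygy hC rs.length
  obtain ⟨hreg, v, hv⟩ := hs.exists_injective rs hrs LinearMap.id Function.injective_id
  have hT := hN.isTotallyReflexive hC c hc hmc hreg
  obtain ⟨y, hy⟩ := Submodule.Quotient.mk_surjective _ (v z)
  -- The desired map is `v` followed by the reduction of a functional on `N` that detects `y` modulo
  -- `rs`.
  have hy0 : y ∉ (Ideal.ofList rs • ⊤ : Submodule R N) := by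
    rw [← Submodule.Quotient.mk_eq_zero, hy]
    exact (map_ne_zero_iff v hv).2 hz
  obtain ⟨f, hf⟩ : ∃ f : N →ₗ[R] C, f y ∉ (Ideal.ofList rs • ⊤ : Submodule R C) := by
    by_contra! h
    exact hy0 (hT.mem_smul_top hC y h)
  refine ⟨Submodule.mapQ _ _ f (Submodule.smul_top_le_comap_smul_top _ f) ∘ₗ v, ?_⟩
  rw [LinearMap.comp_apply, ← hy, Submodule.mapQ_apply, Ne, Submodule.Quotient.mk_eq_zero]
  exact hf

end TotallyReflexive

/-! ### Regular sequences, depth, and the action of `R / (rs)` on `K / (rs) K`. -/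

section RegularSequences

open RingTheory.Sequence

variable {R : Type u} [CommRing R]

lemma length_le_moduleDepth [IsLocalRing R] {rs : List R} (hreg : IsWeaklyRegular R rs)
    (hrs : ∀ r ∈ rs, r ∈ IsLocalRing.maximalIdeal R) : (rs.length : ℕ∞) ≤ moduleDepth R R := by
  have hk : ∀ r ∈ rs, r ∈ Module.annihilator R (IsLocalRing.ResidueField R) := fun r hr => by
    rw [show Module.annihilator R (IsLocalRing.ResidueField R) = IsLocalRing.maximalIdeal R from
      Ideal.annihilator_quotient]
    exact hrs r hr
  refine le_iInf₂ fun i hi => ?_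
  by_contra! h
  have := subsingleton_ext_of_isWeaklyRegular _ rs hk R hreg i (by exact_mod_cast h)
  exact not_nontrivial _ hi

lemma IsSemidualizing.mem_smul_top_iff {K : Type u} [AddCommGroup K] [Module R K]
    (hK : IsSemidualizing R K) {rs : List R}
    (hreg : IsWeaklyRegular K rs) (r : R) :
    r ∈ (Ideal.ofList rs • ⊤ : Submodule R R) ↔
      ∀ k : K, r • k ∈ (Ideal.ofList rs • ⊤ : Submodule R K) := by
  constructor
  · intro hr k
    rw [smul_eq_mul, Ideal.mul_top] at hr
    exact Submodule.smul_mem_smul hr Submodule.mem_top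
  · intro h
    let e := LinearEquiv.ofBijective _ hK.homothety
    have h1 := mem_smul_top_linearMap rs K hreg hK.ext_eq_zero (e r) h
    have h2 := Submodule.mem_map_of_mem (f := e.symm.toLinearMap) h1
    rw [Submodule.map_smul'', Submodule.map_top, LinearEquiv.range] at h2
    simpa using h2

end RegularSequences

/-! ### Associated primes of `R / (rs)` and `K / (rs) K`, and depth. -/

section AssociatedPrimes

open RingTheory.Sequence

variable {R : Type u} [CommRing R] [IsNoetherianRing R]

/-- The annihilator of `x` is the finite intersection of those of the `f j x`, and a prime
containing a finite intersection contains one of its members. -/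
lemma associatedPrimes_subset_of_jointly_injective {M D : Type*} [AddCommGroup M] [Module R M]
    [AddCommGroup D] [Module R D] {ι : Type*} (s : Finset ι) (f : ι → M →ₗ[R] D)
    (h : ∀ x, (∀ j ∈ s, f j x = 0) → x = 0) : associatedPrimes R M ⊆ associatedPrimes R D := by
  intro p hp
  obtain ⟨hp, x, rfl⟩ := isAssociatedPrime_iff.1 hp
  obtain ⟨j, -, hj⟩ := (hp.inf_le' (s := s) (f := fun j => Submodule.colon ⊥ {f j x})).1
    (by
      intro r hr
      rw [Submodule.mem_finsetInf] at hr
      rw [Submodule.mem_colon_singleton, Submodule.mem_bot]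
      refine h _ fun j hj => ?_
      have := hr j hj
      rwa [Submodule.mem_colon_singleton, Submodule.mem_bot, ← map_smul] at this)
  refine isAssociatedPrime_iff.2 ⟨hp, f j x, le_antisymm (fun r hr => ?_) hj⟩
  rw [Submodule.mem_colon_singleton, Submodule.mem_bot] at hr ⊢
  rw [← map_smul, hr, map_zero]

lemma nontrivial_residueField_linearMap_iff [IsLocalRing R] (D : Type u) [AddCommGroup D]
    [Module R D] : Nontrivial (IsLocalRing.ResidueField R →ₗ[R] D) ↔
      IsLocalRing.maximalIdeal R ∈ associatedPrimes R D := by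
  rw [AssociatedPrimes.mem_iff, isAssociatedPrime_iff]
  constructor
  · intro h
    obtain ⟨f, hf⟩ := exists_ne (0 : IsLocalRing.ResidueField R →ₗ[R] D)
    refine ⟨inferInstance, f 1, ?_⟩
    have h1 : f 1 ≠ 0 := by
      intro h1
      refine hf (LinearMap.ext fun x => ?_)
      obtain ⟨r, rfl⟩ := IsLocalRing.residue_surjective x
      have : IsLocalRing.residue R r = r • (1 : IsLocalRing.ResidueField R) := by
        rw [Algebra.smul_def, mul_one]; rfl
      rw [this, map_smul, h1, smul_zero, LinearMap.zero_apply]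
    refine le_antisymm (fun r hr => ?_) (IsLocalRing.le_maximalIdeal fun h => h1 ?_)
    · rw [Submodule.mem_colon_singleton, Submodule.mem_bot, ← map_smul, Algebra.smul_def, mul_one]
      have : algebraMap R (IsLocalRing.ResidueField R) r = 0 :=
        (IsLocalRing.residue_eq_zero_iff r).2 hr
      rw [this, map_zero]
    · have : (1 : R) ∈ (⊥ : Submodule R D).colon {f 1} := h ▸ Submodule.mem_top
      rwa [Submodule.mem_colon_singleton, Submodule.mem_bot, one_smul] at this
  · rintro ⟨-, x, hx⟩
    let f : IsLocalRing.ResidueField R →ₗ[R] D :=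
      (IsLocalRing.maximalIdeal R).liftQ (LinearMap.toSpanSingleton R D x) fun r hr => by
        rw [hx, Submodule.mem_colon_singleton, Submodule.mem_bot] at hr
        exact hr
    refine ⟨f, 0, fun h => ?_⟩
    have hx0 : x = 0 := by
      have := LinearMap.congr_fun h (IsLocalRing.residue R 1)
      change (1 : R) • x = 0 at this
      rwa [one_smul] at this
    have : (1 : R) ∈ IsLocalRing.maximalIdeal R := by
      rw [hx, hx0, Submodule.mem_colon_singleton, smul_zero]
      exact Submodule.zero_mem _
    exact (Ideal.ne_top_iff_one _).1 (IsLocalRing.maximalIdeal.isMaximal R).ne_top this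

lemma one_le_moduleDepth_iff [IsLocalRing R] (D : Type u) [AddCommGroup D] [Module R D] :
    1 ≤ moduleDepth R D ↔ IsLocalRing.maximalIdeal R ∉ associatedPrimes R D := by
  have e : ExtMod R (IsLocalRing.ResidueField R) D 0 ≃ (IsLocalRing.ResidueField R →ₗ[R] D) :=
    (Ext.addEquiv₀.trans ModuleCat.homAddEquiv).toEquiv
  rw [← nontrivial_residueField_linearMap_iff, ← e.nontrivial_congr]
  constructor
  · intro h h0
    have : moduleDepth R D ≤ ((0 : ℕ) : ℕ∞) := iInf₂_le 0 h0
    simpa using h.trans this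
  · intro h
    refine le_iInf₂ fun i hi => ?_
    rcases i with _ | i
    · exact absurd hi h
    · exact_mod_cast Nat.succ_le_succ (Nat.zero_le i)

/-- The groups `Extⁱ(k, R)` vanish below the length of `rs`, and in that degree the group is `Hom(k,
R / (rs))`. -/
lemma moduleDepth_le_length_iff [IsLocalRing R] {rs : List R} (hreg : IsWeaklyRegular R rs)
    (hrs : ∀ r ∈ rs, r ∈ IsLocalRing.maximalIdeal R) : moduleDepth R R ≤ rs.length ↔
      IsLocalRing.maximalIdeal R ∈
        associatedPrimes R (R ⧸ (Ideal.ofList rs • ⊤ : Submodule R R)) := by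
  have hk : ∀ r ∈ rs, r ∈ Module.annihilator R (IsLocalRing.ResidueField R) := fun r hr => by
    rw [show Module.annihilator R (IsLocalRing.ResidueField R) = IsLocalRing.maximalIdeal R from
      Ideal.annihilator_quotient]
    exact hrs r hr
  obtain ⟨β, hβ⟩ := exists_ext_class_bijective rs R hreg
  rw [← nontrivial_residueField_linearMap_iff,
    (Equiv.ofBijective _ (hβ _ hk)).nontrivial_congr]
  constructor
  · intro h
    by_contra h1
    have : ((rs.length + 1 : ℕ) : ℕ∞) ≤ moduleDepth R R := by
      refine le_iInf₂ fun i hi => ?_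
      by_contra! h2
      have h3 : i < rs.length + 1 := by exact_mod_cast h2
      rcases Nat.lt_succ_iff_lt_or_eq.1 h3 with h4 | rfl
      · have := subsingleton_ext_of_isWeaklyRegular _ rs hk R hreg i h4
        exact not_nontrivial _ hi
      · exact h1 hi
    have h5 := this.trans h
    norm_cast at h5
    omega
  · intro h
    exact iInf₂_le rs.length h

variable {K : Type u} [AddCommGroup K] [Module R K]

lemma IsSemidualizing.associatedPrimes_quotient_eq (hK : IsSemidualizing R K) {rs : List R}
    (hreg : IsWeaklyRegular K rs) :
    associatedPrimes R (R ⧸ (Ideal.ofList rs • ⊤ : Submodule R R)) =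
      associatedPrimes R (K ⧸ (Ideal.ofList rs • ⊤ : Submodule R K)) := by
  have := hK.finite
  refine Set.Subset.antisymm ?_ fun p hp => ?_
  -- `R / (rs)` embeds in a finite power of `K / (rs) K` by acting on generators of `K`.
  · obtain ⟨s, hs⟩ := Module.Finite.fg_top (R := R) (M := K)
    refine associatedPrimes_subset_of_jointly_injective s (fun k =>
      Submodule.mapQ _ _ (LinearMap.toSpanSingleton R K k)
        (Submodule.smul_top_le_comap_smul_top _ _)) fun x hx => ?_
    obtain ⟨r, rfl⟩ := Submodule.Quotient.mk_surjective _ x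
    rw [Submodule.Quotient.mk_eq_zero, hK.mem_smul_top_iff hreg]
    have hle : Submodule.span R (s : Set K) ≤
        (Ideal.ofList rs • ⊤ : Submodule R K).comap (LinearMap.lsmul R K r) := by
      refine Submodule.span_le.2 fun k hk => ?_
      exact (Submodule.Quotient.mk_eq_zero (Ideal.ofList rs • ⊤ : Submodule R K)).1 (hx k hk)
    rw [hs] at hle
    exact fun k => hle Submodule.mem_top
  · have hprime := IsAssociatedPrime.isPrime hp
    obtain ⟨-, u, hu⟩ := (isAssociatedPrime_iff_exists_injective_linearMap _ _).1 hp
    -- `K` is faithful, so it has a nonzero map to the domain `R ⧸ p`. The composite with `R ⧸ p → K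
    -- / (rs) K` lifts to an endomorphism of `K`, a homothety `r`, and the class of `r` in `R /
    -- (rs)` has annihilator `p`.
    obtain ⟨g, hg⟩ : ∃ g : K →ₗ[R] R ⧸ p, g ≠ 0 := by
      by_contra! h
      have : Subsingleton (K →ₗ[R] R ⧸ p) := subsingleton_of_forall_eq 0 h
      obtain ⟨r, hr, hreg⟩ := IsSMulRegular.subsingleton_linearMap_iff.1 this
      have hr0 : r = 0 := by
        apply hK.homothety.1
        ext x
        simpa using Module.mem_annihilator.1 hr x
      subst hr0
      exact zero_ne_one (hreg (by simp : (0 : R) • (0 : R ⧸ p) = (0 : R) • (1 : R ⧸ p)))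
    obtain ⟨h, hh⟩ := exists_lift_quotient rs K hreg hK.ext_eq_zero (u ∘ₗ g)
    obtain ⟨r, rfl⟩ := hK.homothety.2 h
    refine isAssociatedPrime_iff.2 ⟨hprime, Submodule.Quotient.mk r, ?_⟩
    ext s
    rw [Submodule.mem_colon_singleton, Submodule.mem_bot, ← Submodule.Quotient.mk_smul,
      Submodule.Quotient.mk_eq_zero, hK.mem_smul_top_iff hreg]
    have key (k : K) : (s • r) • k ∈ (Ideal.ofList rs • ⊤ : Submodule R K) ↔ s • g k = 0 := by
      rw [← map_eq_zero_iff u hu, map_smul, ← Submodule.Quotient.mk_eq_zero, smul_assoc,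
        Submodule.Quotient.mk_smul]
      have := LinearMap.congr_fun hh k
      change Submodule.Quotient.mk (r • k) = u (g k) at this
      rw [this]
    simp only [key]
    constructor
    · intro hs k
      obtain ⟨t, ht⟩ := Ideal.Quotient.mk_surjective (g k)
      rw [← ht, Algebra.smul_def, Ideal.Quotient.algebraMap_eq, Ideal.Quotient.eq_zero_iff_mem.2 hs,
        zero_mul]
    · intro hs
      obtain ⟨k, hk⟩ := DFunLike.ne_iff.1 hg
      have h1 := hs k
      rw [Algebra.smul_def, Ideal.Quotient.algebraMap_eq] at h1
      exact Ideal.Quotient.eq_zero_iff_mem.1 ((mul_eq_zero.1 h1).resolve_right hk)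

end AssociatedPrimes

/-! ### Localizing quotients by `rs` and associated primes. -/

section Localization

open RingTheory.Sequence

variable {R : Type u} [CommRing R] (p : Ideal R) [p.IsPrime]

lemma localized_ofList_smul_top (rs : List R) {M N : Type*} [AddCommGroup M] [Module R M]
    [AddCommGroup N] [Module R N] [Module (Localization.AtPrime p) N]
    [IsScalarTower R (Localization.AtPrime p) N] (f : M →ₗ[R] N)
    [IsLocalizedModule p.primeCompl f] :
    (Ideal.ofList rs • ⊤ : Submodule R M).localized' (Localization.AtPrime p) p.primeCompl f =
      Ideal.ofList (rs.map (algebraMap R (Localization.AtPrime p))) • ⊤ := by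
  rw [Submodule.localized'_smul, Submodule.localized'_top, ← Ideal.map_ofList]
  congr 1
  exact Submodule.localized'_eq_span _ _ _ _

lemma exists_localized_quotient (rs : List R) {M N : Type*} [AddCommGroup M] [Module R M]
    [AddCommGroup N] [Module R N] [Module (Localization.AtPrime p) N]
    [IsScalarTower R (Localization.AtPrime p) N] (f : M →ₗ[R] N)
    [IsLocalizedModule p.primeCompl f] :
    ∃ l : (M ⧸ (Ideal.ofList rs • ⊤ : Submodule R M)) →ₗ[R]
      (N ⧸ (Ideal.ofList (rs.map (algebraMap R (Localization.AtPrime p))) • ⊤ :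
        Submodule (Localization.AtPrime p) N)), IsLocalizedModule p.primeCompl l := by
  rw [← localized_ofList_smul_top p rs f]
  exact ⟨Submodule.toLocalizedQuotient' _ _ _ _, inferInstance⟩

lemma maximalIdeal_mem_associatedPrimes_iff [IsNoetherianRing R] {M N : Type*} [AddCommGroup M]
    [Module R M] [AddCommGroup N] [Module R N] [Module (Localization.AtPrime p) N]
    [IsScalarTower R (Localization.AtPrime p) N] (f : M →ₗ[R] N)
    [IsLocalizedModule p.primeCompl f] :
    IsLocalRing.maximalIdeal (Localization.AtPrime p) ∈
      associatedPrimes (Localization.AtPrime p) N ↔ p ∈ associatedPrimes R M := by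
  rw [← Module.associatedPrimes.preimage_comap_associatedPrimes_eq_associatedPrimes_of_isLocalizedModule
    p.primeCompl f (R' := Localization.AtPrime p), Set.mem_preimage]
  rw [show Ideal.comap (algebraMap R (Localization.AtPrime p))
    (IsLocalRing.maximalIdeal (Localization.AtPrime p)) = p from
    Localization.AtPrime.under_maximalIdeal]

lemma algebraMap_mem_maximalIdeal_of_mem {rs : List R} (hrs : ∀ r ∈ rs, r ∈ p) :
    ∀ r ∈ rs.map (algebraMap R (Localization.AtPrime p)),
      r ∈ IsLocalRing.maximalIdeal (Localization.AtPrime p) := by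
  intro r hr
  obtain ⟨a, ha, rfl⟩ := List.mem_map.1 hr
  exact (IsLocalization.AtPrime.to_map_mem_maximal_iff _ p a).2 (hrs a ha)

lemma length_le_depthRingAt {R : Type u} [CommRing R] (p : PrimeSpectrum R) {rs : List R}
    (hreg : IsWeaklyRegular R rs) (hrs : ∀ r ∈ rs, r ∈ p.asIdeal) :
    (rs.length : ℕ∞) ≤ depthRingAt p := by
  have := length_le_moduleDepth
    (hreg.of_isLocalization (Localization.AtPrime p.asIdeal) p.asIdeal.primeCompl)
    (algebraMap_mem_maximalIdeal_of_mem p.asIdeal hrs)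
  rwa [List.length_map] at this

end Localization

/-! ### Depth at a prime in terms of associated primes. -/

section DepthAt

open RingTheory.Sequence

variable {R : Type u} [CommRing R] [IsNoetherianRing R] (p : PrimeSpectrum R)

lemma one_le_depthAt_iff (M : Type u) [AddCommGroup M] [Module R M] :
    1 ≤ depthAt p M ↔ p.asIdeal ∉ associatedPrimes R M := by
  rw [← maximalIdeal_mem_associatedPrimes_iff p.asIdeal
    (LocalizedModule.mkLinearMap p.asIdeal.primeCompl M)]
  exact one_le_moduleDepth_iff _

variable {rs : List R}

lemma depthRingAt_le_length_iff (hreg : IsWeaklyRegular R rs) (hrs : ∀ r ∈ rs, r ∈ p.asIdeal) :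
    depthRingAt p ≤ rs.length ↔
      p.asIdeal ∈ associatedPrimes R (R ⧸ (Ideal.ofList rs • ⊤ : Submodule R R)) := by
  have := moduleDepth_le_length_iff
    (hreg.of_isLocalization (Localization.AtPrime p.asIdeal) p.asIdeal.primeCompl)
    (algebraMap_mem_maximalIdeal_of_mem p.asIdeal hrs)
  rw [List.length_map] at this
  obtain ⟨l, hl⟩ := exists_localized_quotient p.asIdeal rs
    (Algebra.linearMap R (Localization.AtPrime p.asIdeal))
  exact this.trans (maximalIdeal_mem_associatedPrimes_iff p.asIdeal l)

end DepthAt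

/-! ### Torsionless modules: associated primes and the local criterion. -/

section Torsionless

open RingTheory.Sequence

variable {R : Type u} [CommRing R] [IsNoetherianRing R] {K : Type u} [AddCommGroup K] [Module R K]
  {M : Type u} [AddCommGroup M] [Module R M] [Module.Finite R M] {rs : List R}

lemma associatedPrimes_subset_of_torsionless {D : Type u} [AddCommGroup D] [Module R D]
    [Module.Finite R D] (h : ∀ z : M, (∀ f : M →ₗ[R] D, f z = 0) → z = 0) :
    associatedPrimes R M ⊆ associatedPrimes R D := by
  obtain ⟨s, hs⟩ := Module.Finite.fg_top (R := R) (M := M →ₗ[R] D)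
  refine associatedPrimes_subset_of_jointly_injective s id fun x hx => h x fun f => ?_
  have hle : Submodule.span R (s : Set (M →ₗ[R] D)) ≤ LinearMap.ker (LinearMap.applyₗ x) :=
    Submodule.span_le.2 hx
  rw [hs] at hle
  exact hle Submodule.mem_top

/-- The local criterion: `M` is `K / (rs) K`-torsionless if every `𝔭 ∈ Ass M` is associated to
`K / (rs) K` and `M_𝔭` has finite `G_{K_𝔭}`-dimension. -/
lemma torsionless_of_associatedPrimes [Module.Finite R K] (hK : IsWeaklyRegular K rs)
    (hrs : ∀ r ∈ rs, r ∈ Module.annihilator R M)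
    (h : ∀ p : PrimeSpectrum R, p.asIdeal ∈ associatedPrimes R M →
      p.asIdeal ∈ associatedPrimes R (K ⧸ (Ideal.ofList rs • ⊤ : Submodule R K)) ∧
      gkDim (Localization.AtPrime p.asIdeal) (LocalizedModule.AtPrime p.asIdeal K)
        (LocalizedModule.AtPrime p.asIdeal M) < ⊤) (z : M)
    (hz : ∀ f : M →ₗ[R] (K ⧸ (Ideal.ofList rs • ⊤ : Submodule R K)), f z = 0) : z = 0 := by
  by_contra hz0
  let N : Submodule R M := ⨅ f : M →ₗ[R] (K ⧸ (Ideal.ofList rs • ⊤ : Submodule R K)),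
    LinearMap.ker f
  have hzN : z ∈ N := (Submodule.mem_iInf _).2 hz
  have : Nontrivial N := ⟨⟨z, hzN⟩, 0, fun h => hz0 (congrArg Subtype.val h)⟩
  -- Localizing at an associated prime of the torsion part `N` itself keeps an element `y ∈ N` with
  -- annihilator `q` nonzero.
  obtain ⟨q, hq⟩ := associatedPrimes.nonempty R N
  obtain ⟨hprime, y, hy⟩ := isAssociatedPrime_iff.1 hq
  let p : PrimeSpectrum R := ⟨q, hprime⟩
  obtain ⟨hass, hgk⟩ := h p (associatedPrimes.subset_of_injective N.injective_subtype hq)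
  have hd : ∃ d, HasGKResolution (Localization.AtPrime p.asIdeal)
      (LocalizedModule.AtPrime p.asIdeal K) d (LocalizedModule.AtPrime p.asIdeal M) := by
    obtain ⟨d, hd⟩ := iInf_lt_iff.1 hgk
    obtain ⟨hd, -⟩ := iInf_lt_iff.1 hd
    exact ⟨d, hd⟩
  obtain ⟨d, hd⟩ := hd
  obtain ⟨l, hl⟩ := exists_localized_quotient p.asIdeal rs
    (LocalizedModule.mkLinearMap p.asIdeal.primeCompl K)
  have hC := hK.of_isLocalizedModule (Localization.AtPrime p.asIdeal) p.asIdeal.primeCompl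
    (LocalizedModule.mkLinearMap p.asIdeal.primeCompl K)
  obtain ⟨hmp, c, hc⟩ := isAssociatedPrime_iff.1
    ((maximalIdeal_mem_associatedPrimes_iff p.asIdeal l).2 hass)
  have hc0 : c ≠ 0 := by
    rintro rfl
    refine (Ideal.ne_top_iff_one _).1 hmp.ne_top ?_
    rw [hc, Submodule.mem_colon_singleton, smul_zero]
    exact Submodule.zero_mem _
  have hmc : ∀ r ∈ IsLocalRing.maximalIdeal (Localization.AtPrime p.asIdeal), r • c = 0 := by
    intro r hr
    rwa [hc, Submodule.mem_colon_singleton, Submodule.mem_bot] at hr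
  have hann : ∀ r ∈ rs.map (algebraMap R (Localization.AtPrime p.asIdeal)),
      r ∈ Module.annihilator (Localization.AtPrime p.asIdeal)
        (LocalizedModule.AtPrime p.asIdeal M) := by
    intro r hr
    obtain ⟨a, ha, rfl⟩ := List.mem_map.1 hr
    refine Module.mem_annihilator.2 fun x => ?_
    obtain ⟨⟨m, s⟩, rfl⟩ := IsLocalizedModule.mk'_surjective p.asIdeal.primeCompl
      (LocalizedModule.mkLinearMap p.asIdeal.primeCompl M) x
    rw [algebraMap_smul, Function.uncurry_apply_pair, ← IsLocalizedModule.mk'_smul,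
      Module.mem_annihilator.1 (hrs a ha), IsLocalizedModule.mk'_zero]
  have hy0 : LocalizedModule.mkLinearMap p.asIdeal.primeCompl M y ≠ 0 := by
    intro h0
    obtain ⟨s, hs⟩ := (IsLocalizedModule.eq_zero_iff p.asIdeal.primeCompl _).1 h0
    refine s.2 ?_
    change (s : R) ∈ q
    rw [hy, Submodule.mem_colon_singleton, Submodule.mem_bot]
    exact Subtype.ext hs
  obtain ⟨g, hg⟩ := hd.exists_linearMap_ne_zero hC c hc0 hmc hann _ hy0
  have := Module.finitePresentation_of_finite R M
  -- Up to some `s ∉ q` the local functional comes from a global `f`, which kills `y ∈ N`; this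
  -- contradicts `g y ≠ 0`.
  obtain ⟨f, s, hf⟩ := Module.FinitePresentation.exists_lift_of_isLocalizedModule
    p.asIdeal.primeCompl l
    (g.restrictScalars R ∘ₗ LocalizedModule.mkLinearMap p.asIdeal.primeCompl M)
  have h1 := LinearMap.congr_fun hf y
  have h2 : f y = 0 := (Submodule.mem_iInf _).1 y.2 f
  rw [LinearMap.comp_apply, h2, map_zero] at h1
  exact hg ((IsLocalizedModule.smul_injective l s) (by simpa using h1.symm))

end Torsionless

end ReflexiveLinkage

/-! ### The three conditions as a bound on `depth R_𝔭` for `𝔭 ∈ Ass M`. -/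

theorem mainTheorem11 {R : Type u} [CommRing R] [IsNoetherianRing R]
    (K : Type u) [AddCommGroup K] [Module R K] (hK : IsSemidualizing R K) (n : ℕ)
    (𝒳 : CategoryTheory.ObjectProperty (ModuleCat.{u} R)) (h𝒳 : IsNReflexive K n 𝒳)
    {X M : Type u} [AddCommGroup X] [Module R X] [AddCommGroup M] [Module R M]
    (φ : X →ₗ[R] M) (hφ : IsEpiFrom 𝒳 φ) (hφ_inj : ¬ Function.Injective φ)
    (hM : HasFiniteGKDimOn R K n M) :
    List.TFAE [
      IsLinkedBy K n φ,
      IsGradeUnmixed R M,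
      ∀ p : PrimeSpectrum R, min 1 (depthRingAt p - (n : ℕ∞)) ≤ depthAt p M] := by
  have hX := h𝒳.isReflexive _ hφ.source_mem
  have : Module.Finite R X := hX.finite
  have := hφ.finite
  have := hK.finite
  have hgX : moduleGrade R X = n := hX.grade_eq
  have hgM : moduleGrade R M = n := hφ.grade_eq.trans hgX
  have hMn : Nontrivial M := by
    by_contra h
    rw [not_nontrivial_iff_subsingleton] at h
    have : (⊤ : ℕ∞) ≤ moduleGrade R M := le_iInf₂ fun i hi =>
      absurd hi (not_nontrivial_iff_subsingleton.2 (subsingleton_ext_of_subsingleton i))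
    rw [hgM] at this
    exact ENat.natCast_ne_top n (top_le_iff.1 this)
  obtain ⟨rs, hlen, hrs, hreg⟩ := ModuleCat.exists_isRegular_of_exists_subsingleton_ext
    (Module.annihilator R M) n (ModuleCat.of R R)
    (by simpa using lt_top_iff_ne_top.2 (mt Module.annihilator_eq_top_iff.1 (not_subsingleton M)))
    (ModuleCat.of R M) Module.support_eq_zeroLocus (fun i hi => by
      by_contra h
      rw [not_subsingleton_iff_nontrivial] at h
      have : moduleGrade R M ≤ i := iInf₂_le i h
      rw [hgM] at this
      exact absurd hi (by exact_mod_cast this.not_gt))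
  replace hreg : RingTheory.Sequence.IsWeaklyRegular R rs := hreg.toIsWeaklyRegular
  replace hrs : ∀ r ∈ rs, r ∈ Module.annihilator R M := hrs
  subst hlen
  have hKreg : RingTheory.Sequence.IsWeaklyRegular K rs := hK.isWeaklyRegular rs K hK.ext_eq_zero
    ((LinearEquiv.isWeaklyRegular_congr (LinearEquiv.ofBijective _ hK.homothety) rs).1 hreg)
  have hmem (p : PrimeSpectrum R) (hp : p.asIdeal ∈ associatedPrimes R M) :
      ∀ r ∈ rs, r ∈ p.asIdeal := fun r hr => by
    refine IsAssociatedPrime.annihilator_le hp ?_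
    rw [Submodule.annihilator_top]
    exact hrs r hr
  have h1 : IsLinkedBy K rs.length φ ↔
      ∀ p : PrimeSpectrum R, p.asIdeal ∈ associatedPrimes R M → depthRingAt p ≤ rs.length := by
    rw [isLinkedBy_iff_injective_eta hK hgX.ge hgM.ge hX.bijective_eta.2 φ hφ.surjective,
      injective_iff_map_eq_zero]
    simp only [eta_eq_zero_iff hK rs hgM.ge hrs hKreg]
    constructor
    · intro h p hp
      rw [depthRingAt_le_length_iff p hreg (hmem p hp), hK.associatedPrimes_quotient_eq hKreg]
      exact associatedPrimes_subset_of_torsionless h hp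
    · intro h
      -- The bound on the depth plays two roles: it puts `p` in `Ass (K / (rs) K)` and makes `hM`
      -- applicable at `p`.
      refine torsionless_of_associatedPrimes hKreg hrs fun p hp => ⟨?_, hM p (h p hp)⟩
      rw [← hK.associatedPrimes_quotient_eq hKreg, ← depthRingAt_le_length_iff p hreg (hmem p hp)]
      exact h p hp
  have h2 : IsGradeUnmixed R M ↔
      ∀ p : PrimeSpectrum R, p.asIdeal ∈ associatedPrimes R M → depthRingAt p ≤ rs.length := by
    refine forall₂_congr fun p hp => ?_
    rw [hgM]
    -- The inequality `n ≤ depth R_𝔭` is automatic, as `𝔭` contains the regular sequence `rs`.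
    exact ⟨fun h => h.ge, fun h => le_antisymm (length_le_depthRingAt p hreg (hmem p hp)) h⟩
  have h3 : (∀ p : PrimeSpectrum R, min 1 (depthRingAt p - (rs.length : ℕ∞)) ≤ depthAt p M) ↔
      ∀ p : PrimeSpectrum R, p.asIdeal ∈ associatedPrimes R M → depthRingAt p ≤ rs.length := by
    -- Only primes with `depth M_𝔭 = 0`, the associated ones, impose a condition; there the
    -- truncated difference `depth R_𝔭 - n` must vanish.
    refine forall_congr' fun p => ?_
    constructor
    · intro h hp
      have h0 : depthAt p M = 0 := by
        by_contra h0
        exact (one_le_depthAt_iff p M).1 (Order.one_le_iff_pos.2 (pos_iff_ne_zero.2 h0)) hp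
      rw [h0, nonpos_iff_eq_zero] at h
      rcases min_eq_bot.1 h with h | h
      · exact absurd h one_ne_zero
      · exact tsub_eq_zero_iff_le.1 h
    · intro h
      by_cases hp : p.asIdeal ∈ associatedPrimes R M
      · rw [tsub_eq_zero_iff_le.2 (h hp)]
        simp
      · exact (min_le_left _ _).trans ((one_le_depthAt_iff p M).2 hp)
  tfae_have 1 ↔ 2 := h1.trans h2.symm
  tfae_have 2 ↔ 3 := h2.trans h3.symm
  tfae_finish
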